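/- Let $m\ge 1$ and let $X\subseteq\{0,1\}^m$ be a set such that for every $j\in\{1,\dots,m\}$ both values $0$ and $1$ occur as the $j$-th coordinate of some element of $X$. For $n\ge 2$, an $n$-ary aggregator for $X$ is a tuple $\bar f=(f_1,\dots,f_m)$ of functions $f_j:\{0,1\}^n\to\{0,1\}$ such that (i) $f_j(a_1,\dots,a_n)\in\{a_1,\dots,a_n\}$ for all $j$ and all $a_1,\dots,a_n\in\{0,1\}$, and (ii) for all $x^1,\dots,x^n\in X$ the tuple $\bar f(x^1,\dots,x^n):=\big(f_1(x^1_1,\dots,x^n_1),\dots,f_m(x^1_m,\dots,x^n_m)\big)$ belongs to $X$. It is dictatorial on $X$ if there is $d\in\{1,\dots,n\}$ with $\bar f(x^1,\dots,x^n)=x^d$ for all $x^1,\dots,x^n\in X$, and non-dictatorial otherwise. The set $X$ is a possibility domain if it has a non-dictatorial aggregator of some arity $n\ge 2$. It is affine if $x\oplus y\oplus z\in X$ for all $x,y,z\in X$, where $\oplus$ is coordinatewise addition modulo $2$. There is a polynomial-time algorithm (a Turing machine whose running time is bounded by a polynomial in the length of its input) which, given such a set $X$ explicitly by a list of its elements,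 for arbitrary $m\ge 1$, decides whether $X$ is a possibility domain. It answers "yes" exactly when $X$ admits a binary (that is, $2$-ary) non-dictatorial aggregator or $X$ is affine. -/

import Mathlib

namespace Aggregation

/-- An evaluation on `m` issues in the Boolean framework: an element of `{0,1}^m`. -/
abbrev Evaluation (m : ℕ) : Type := Fin m → Bool

/-- Non-degeneracy of a set of feasible evaluations: for each issue `j`, the projection `X_j`
of `X` has at least two elements. -/
def Nondegenerate {m : ℕ} (X : Set (Evaluation m)) : Prop :=
  ∀ j : Fin m, ((fun x : Evaluation m => x j) '' X).Nontrivial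

/-- Issue-by-issue aggregation of the evaluations `x 0, …, x (n-1)` of `n` individuals:
the `j`-th component is `f j` applied to the column of opinions on issue `j`. -/
def aggregate {m n : ℕ} (f : Fin m → (Fin n → Bool) → Bool) (x : Fin n → Evaluation m) :
    Evaluation m :=
  fun j => f j (fun i => x i j)

/-- `f = (f_1, …, f_m)` is an `n`-ary aggregator for `X`: every component is conservative, and
aggregating feasible evaluations gives a feasible evaluation. -/
structure IsAggregator {m n : ℕ} (X : Set (Evaluation m))
    (f : Fin m → (Fin n → Bool) → Bool) : Prop where
  conservative : ∀ (j : Fin m) (a : Fin n → Bool), ∃ i : Fin n, f j a = a i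
  closed : ∀ x : Fin n → Evaluation m, (∀ i, x i ∈ X) → aggregate f x ∈ X

/-- `f` restricted to `X` is the projection to one individual `d`, the same for all issues. -/
def IsDictatorialOn {m n : ℕ} (X : Set (Evaluation m))
    (f : Fin m → (Fin n → Bool) → Bool) : Prop :=
  ∃ d : Fin n, ∀ x : Fin n → Evaluation m, (∀ i, x i ∈ X) → aggregate f x = x d

/-- `X` admits an `n`-ary non-dictatorial aggregator. -/
def AdmitsNonDictatorial {m : ℕ} (X : Set (Evaluation m)) (n : ℕ) : Prop :=
  ∃ f : Fin m → (Fin n → Bool) → Bool, IsAggregator X f ∧ ¬ IsDictatorialOn X f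

/-- `X` is a possibility domain: it has a non-dictatorial aggregator of some arity `n ≥ 2`. -/
def IsPossibilityDomain {m : ℕ} (X : Set (Evaluation m)) : Prop :=
  ∃ n : ℕ, 2 ≤ n ∧ AdmitsNonDictatorial X n

/-- `X` is affine: it is closed under the coordinatewise ternary operation `x ⊕ y ⊕ z`. -/
def IsAffine {m : ℕ} (X : Set (Evaluation m)) : Prop :=
  ∀ x ∈ X, ∀ y ∈ X, ∀ z ∈ X, (fun j => xor (xor (x j) (y j)) (z j)) ∈ X

/-- An input of the decision problem: a non-degenerate set of feasible evaluations on `m ≥ 1`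
issues, given explicitly by a list of its elements (in any order; repetitions are harmless). -/
structure Instance where
  m : ℕ
  m_pos : 1 ≤ m
  rows : List (Evaluation m)
  nondegenerate : Nondegenerate {x | x ∈ rows}

/-- The set of feasible evaluations that an input lists. -/
def Instance.X (I : Instance) : Set (Evaluation I.m) := {x | x ∈ I.rows}

/-- The input word, over the three-letter alphabet `0`, `1` (as `some b`) and an end-of-row
marker (`none`): the listed evaluations are written out one after the other. -/
def Instance.encode (I : Instance) : List (Option Bool) :=
  I.rows.flatMap fun x => (List.ofFn x).map some ++ [none]

end Aggregation

/-! Suppose that all binary aggregators of `X` are dictatorial. Identifying individuals turns any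
aggregator into binary ones, and their dictators show that all its components are one self-dual
function `W` (`IsAggregator.exists_uniform`). If `W` is additive on disjoint sets of individuals, it
is a projection. Otherwise some ternary minor of `W` is majority, a Pixley operation (which
generates majority), or `x ⊕ y ⊕ z`. Majority with one argument fixed in `X` would be a
non-dictatorial binary aggregator, so only the sum remains and `X` is affine. This gives
`isPossibilityDomain_iff`.

Affinity is tested on all triples. For the binary case, a conservative binary operation on one issue
amounts to two bits, so a binary aggregator is a set of literals. Given some literals of an
aggregator, pairs in `X` force further ones, and every set closed under forcing comes from an
aggregator (`Literals.Closed.isAggregator`). The dictators are the full and the empty set. Up to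
exchanging the individuals, a literal of the first issue is present, so it suffices to close each of
its two literals and to see whether the result is full (`admitsNonDictatorial_two_iff_round`). As
there are `2 * m` literals, `2 * m` rounds suffice.

For the time bound, the procedure is written in a small language of loops over rows and sweeps over
issues. Every program of the language compiles to a stack machine with a polynomial time bound
(`code_reaches`, `machine_outputs`), and `answer_effect_decision` identifies the result of this
particular program. -/

namespace Aggregation

/-! ### Characterisation of possibility domains -/

variable {m n : ℕ} {X : Set (Evaluation m)}

theorem Nondegenerate.exists_eq (hX : Nondegenerate X) (j : Fin m) (b : Bool) :
    ∃ x ∈ X, x j = b := by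
  obtain ⟨_, ⟨x, hx, rfl⟩, _, ⟨y, hy, rfl⟩, hxy⟩ := hX j
  by_cases h : x j = b
  · exact ⟨x, hx, h⟩
  · refine ⟨y, hy, ?_⟩
    simp only at hxy
    revert h hxy
    cases x j <;> cases y j <;> cases b <;> simp

/-- By non-degeneracy every column of opinions on a single issue occurs in some profile from `X`, so
restricting to `X` loses nothing. -/
theorem Nondegenerate.isDictatorialOn_iff (hX : Nondegenerate X)
    (f : Fin m → (Fin n → Bool) → Bool) :
    IsDictatorialOn X f ↔ ∃ d, ∀ j a, f j a = a d := by
  constructor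
  · rintro ⟨d, hd⟩
    refine ⟨d, fun j a => ?_⟩
    choose x hx hxa using fun i => hX.exists_eq j (a i)
    have := congrFun (hd x hx) j
    simpa [aggregate, hxa] using this
  · rintro ⟨d, hd⟩
    exact ⟨d, fun x _ => funext fun j => hd j _⟩

/-- Identifying and permuting the individuals of an aggregator gives an aggregator. -/
theorem IsAggregator.minor {k : ℕ} {f : Fin m → (Fin n → Bool) → Bool} (hf : IsAggregator X f)
    (π : Fin n → Fin k) : IsAggregator X (fun j a => f j (a ∘ π)) where
  conservative j a := by
    obtain ⟨i, hi⟩ := hf.conservative j (a ∘ π)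
    exact ⟨π i, hi⟩
  closed x hx := hf.closed (x ∘ π) fun i => hx (π i)

/-- Fixing the third voter at `z ∈ X` turns majority on issue `j` into conjunction or disjunction,
according to `z j`; neither is a projection. -/
theorem admitsNonDictatorial_two_of_majority (hm : 1 ≤ m) (hX : Nondegenerate X)
    (h : ∀ x ∈ X, ∀ y ∈ X, ∀ z ∈ X, (fun j => (x j && y j) || (x j && z j) || (y j && z j)) ∈ X) :
    AdmitsNonDictatorial X 2 := by
  obtain ⟨z, hz, -⟩ := hX.exists_eq ⟨0, hm⟩ true
  refine ⟨fun j a => (a 0 && a 1) || (a 0 && z j) || (a 1 && z j), ⟨fun j a => ?_, fun x hx => ?_⟩,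
    ?_⟩
  · rcases h0 : a 0 <;> rcases h1 : a 1 <;> rcases z j <;> simp [Fin.exists_fin_two, h0, h1]
  · exact h _ (hx 0) _ (hx 1) _ hz
  · rw [hX.isDictatorialOn_iff]
    rintro ⟨d, hd⟩
    have h1 := hd ⟨0, hm⟩ ![true, false]
    have h2 := hd ⟨0, hm⟩ ![false, true]
    revert h1 h2
    fin_cases d <;> rcases z ⟨0, hm⟩ <;> simp

theorem IsAffine.admitsNonDictatorial_three (hm : 1 ≤ m) (hX : Nondegenerate X) (h : IsAffine X) :
    AdmitsNonDictatorial X 3 := by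
  refine ⟨fun j a => xor (xor (a 0) (a 1)) (a 2), ⟨fun j a => ?_, fun x hx => ?_⟩, ?_⟩
  · rcases h0 : a 0 <;> rcases h1 : a 1 <;> rcases h2 : a 2 <;>
      simp [Fin.exists_fin_succ, h0, h1, h2]
  · exact h _ (hx 0) _ (hx 1) _ (hx 2)
  · rw [hX.isDictatorialOn_iff]
    rintro ⟨d, hd⟩
    have h1 := hd ⟨0, hm⟩ ![true, false, false]
    have h2 := hd ⟨0, hm⟩ ![false, true, false]
    revert h1 h2
    fin_cases d <;> simp

/-- If all binary aggregators are dictatorial, then the components of an aggregator coincide and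
are self-dual. -/
theorem IsAggregator.exists_uniform (hX : Nondegenerate X) (hB : ¬ AdmitsNonDictatorial X 2)
    {f : Fin m → (Fin n → Bool) → Bool} (hf : IsAggregator X f) :
    ∃ W : (Fin n → Bool) → Bool, (∀ j a, f j a = W a) ∧
      ∀ a, 0 < m → W (fun i => !a i) = !W a := by
  -- Splitting the individuals into `A` and its complement gives a binary minor; its dictator says,
  -- for all issues at once, which side wins.
  have key : ∀ A : Fin n → Bool, ∃ w : Bool, ∀ j, f j A = w ∧ f j (fun i => !A i) = !w := by
    intro A
    have hg := hf.minor (fun i => if A i then (0 : Fin 2) else 1)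
    have hd : IsDictatorialOn X (fun j (a : Fin 2 → Bool) =>
        f j (a ∘ fun i => if A i then (0 : Fin 2) else 1)) := by
      by_contra h
      exact hB ⟨_, hg, h⟩
    obtain ⟨d, hd⟩ := (hX.isDictatorialOn_iff _).1 hd
    have e1 : (![true, false] ∘ fun i => if A i then (0 : Fin 2) else 1) = A := by
      funext i; rcases h : A i <;> simp [h]
    have e2 : (![false, true] ∘ fun i => if A i then (0 : Fin 2) else 1) = fun i => !A i := by
      funext i; rcases h : A i <;> simp [h]
    refine ⟨![true, false] d, fun j => ?_⟩
    have h1 := hd j ![true, false]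
    have h2 := hd j ![false, true]
    rw [e1] at h1
    rw [e2] at h2
    refine ⟨h1, h2.trans ?_⟩
    fin_cases d <;> rfl
  choose W hW using key
  refine ⟨W, fun j a => (hW a j).1, fun a hm => ?_⟩
  rw [← (hW a ⟨0, hm⟩).2, (hW _ ⟨0, hm⟩).1]

/-- A self-dual Boolean function that satisfies the unit-partition law is a projection. -/
theorem exists_projection_of_partition (W : (Fin n → Bool) → Bool)
    (hneg : ∀ a, W (fun i => !a i) = !W a) (htrue : W (fun _ => true) = true)
    (hor : ∀ a b : Fin n → Bool, (∀ i, (a i && b i) = false) →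
      W (fun i => a i || b i) = (W a || W b)) :
    ∃ d, ∀ a, W a = a d := by
  -- If no singleton won, additivity would make every set of individuals lose, including the set of
  -- all of them.
  have hsingle : ∃ d, W (fun i => decide (i = d)) = true := by
    by_contra! h
    have hs : ∀ s : Finset (Fin n), W (fun i => decide (i ∈ s)) = false := by
      intro s
      induction s using Finset.induction_on with
      | empty => simpa [htrue] using hneg (fun _ => true)
      | insert d s hd ih =>
        have := hor (fun i => decide (i = d)) (fun i => decide (i ∈ s)) (fun i => by
          by_cases hi : i = d
          · subst hi; simp [hd]
          · simp [hi])
        rw [ih] at this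
        simpa [h d] using this
    have := hs Finset.univ
    simp [htrue] at this
  obtain ⟨d, hd⟩ := hsingle
  have hmem : ∀ a : Fin n → Bool, a d = true → W a = true := by
    intro a ha
    have := hor (fun i => decide (i = d)) (fun i => a i && !decide (i = d)) (fun i => by
      by_cases hi : i = d <;> simp [hi])
    rw [hd, Bool.true_or] at this
    rw [← this]
    congr 1
    funext i
    by_cases hi : i = d
    · subst hi; simp [ha]
    · simp [hi]
  refine ⟨d, fun a => ?_⟩
  rcases h : a d
  · have := hmem (fun i => !a i) (by simp [h])
    rw [hneg] at this
    simpa using this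
  · exact hmem a h

theorem isAffine_of_admitsNonDictatorial (hm : 1 ≤ m) (hX : Nondegenerate X)
    (hB : ¬ AdmitsNonDictatorial X 2) (h : AdmitsNonDictatorial X n) : IsAffine X := by
  by_contra hA
  obtain ⟨f, hf, hnd⟩ := h
  obtain ⟨W, hW, hneg⟩ := hf.exists_uniform hX hB
  replace hneg := fun a => hneg a hm
  refine hnd ((hX.isDictatorialOn_iff f).2 ?_)
  have htrue : W (fun _ => true) = true := by
    obtain ⟨i, hi⟩ := hf.conservative ⟨0, hm⟩ (fun _ => true)
    rw [← hW ⟨0, hm⟩, hi]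
  have hclosed : ∀ x : Fin n → Evaluation m, (∀ i, x i ∈ X) →
      (fun j => W (fun i => x i j)) ∈ X := by
    intro x hx
    have := hf.closed x hx
    unfold aggregate at this
    simpa only [hW] using this
  suffices hor : ∀ a b : Fin n → Bool, (∀ i, (a i && b i) = false) →
      W (fun i => a i || b i) = (W a || W b) by
    obtain ⟨d, hd⟩ := exists_projection_of_partition W hneg htrue hor
    exact ⟨d, fun j a => by rw [hW, hd]⟩
  intro a b hab
  -- The ternary minor of `W` for the blocks `a`, `b` and the rest. Being self-dual and idempotent,
  -- it is determined by its values at 100, 010 and 110.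
  let t : Bool → Bool → Bool → Bool := fun x y z =>
    W (fun i => if a i then x else if b i then y else z)
  have ht : ∀ x ∈ X, ∀ y ∈ X, ∀ z ∈ X, (fun j => t (x j) (y j) (z j)) ∈ X := by
    intro x hx y hy z hz
    have := hclosed (fun i => if a i then x else if b i then y else z) (fun i => by
      split_ifs <;> assumption)
    convert this using 3
    funext i
    split_ifs <;> rfl
  have tneg : ∀ x y z, t (!x) (!y) (!z) = !t x y z := by
    intro x y z
    simp only [t]
    rw [← hneg]
    congr 1
    funext i
    split_ifs <;> rfl
  have t111 : t true true true = true := by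
    simp only [t, ite_self, htrue]
  have ta : t true false false = W a := by
    simp only [t]; congr 1; funext i; rcases a i <;> simp
  have tb : t false true false = W b := by
    simp only [t]; congr 1; funext i
    have := hab i
    rcases h1 : a i
    · rcases b i <;> rfl
    · simp only [h1, Bool.true_and] at this
      simp [this]
  have tc : t true true false = W (fun i => a i || b i) := by
    simp only [t]; congr 1; funext i; rcases a i <;> rcases b i <;> simp
  have n1 := tneg true true true
  have n2 := tneg true false false
  have n3 := tneg false true false
  have n4 := tneg true true false
  simp only [Bool.not_true, Bool.not_false] at n1 n2 n3 n4
  have hmaj : ¬ ∀ x ∈ X, ∀ y ∈ X, ∀ z ∈ X,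
      (fun j => (x j && y j) || (x j && z j) || (y j && z j)) ∈ X :=
    fun h => hB (admitsNonDictatorial_two_of_majority hm hX h)
  rw [← ta, ← tb, ← tc]
  clear ta tb tc tneg
  clear_value t
  -- Of the eight possible tables, four obey the law and close by `rfl`.
  rcases h1 : t true false false <;> rcases h2 : t false true false <;>
    rcases h3 : t true true false <;> rw [h1] at n2 <;> rw [h2] at n3 <;> rw [h3] at n4 <;>
    rw [t111] at n1 <;> simp only [Bool.not_true, Bool.not_false] at n1 n2 n3 n4 <;>
    try rfl
  -- Values 0, 0, 1: `t` is majority.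
  · refine (hmaj fun x hx y hy z hz => ?_).elim
    convert ht x hx y hy z hz using 2 with j
    rcases x j <;> rcases y j <;> rcases z j <;> simp only [*] <;> rfl
  -- Values 0, 1, 0: `t` is the disjunction of `y` and `z` if `x` is 0 and their conjunction if `x`
  -- is 1. Composing this Pixley operation with itself gives majority.
  · refine (hmaj fun x hx y hy z hz => ?_).elim
    convert ht _ (ht y hy x hx z hz) x hx z hz using 2 with j
    rcases x j <;> rcases y j <;> rcases z j <;> simp only [*] <;> rfl
  -- Values 1, 0, 0: the same operation with `y` as the pivot.
  · refine (hmaj fun x hx y hy z hz => ?_).elim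
    convert ht x hx _ (ht x hx y hy z hz) z hz using 2 with j
    rcases x j <;> rcases y j <;> rcases z j <;> simp only [*] <;> rfl
  -- Values 1, 1, 0: `t` is the sum.
  · refine (hA fun x hx y hy z hz => ?_).elim
    convert ht x hx y hy z hz using 2 with j
    rcases x j <;> rcases y j <;> rcases z j <;> simp only [*] <;> rfl

theorem isPossibilityDomain_iff (hm : 1 ≤ m) (hX : Nondegenerate X) :
    IsPossibilityDomain X ↔ AdmitsNonDictatorial X 2 ∨ IsAffine X := by
  constructor
  · rintro ⟨n, -, h⟩
    by_cases hB : AdmitsNonDictatorial X 2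
    · exact Or.inl hB
    · exact Or.inr (isAffine_of_admitsNonDictatorial hm hX hB h)
  · rintro (h | h)
    · exact ⟨2, le_rfl, h⟩
    · exact ⟨3, by norm_num, h.admitsNonDictatorial_three hm hX⟩

/-! ### Binary aggregators as sets of literals -/

/-- A set of literals: `S j b` says that the binary operation on issue `j` sends `(b, !b)` to
`b`. -/
abbrev Literals (m : ℕ) : Type := Fin m → Bool → Bool

/-- The binary operations that a set of literals describes. -/
def Literals.op (S : Literals m) (j : Fin m) (a : Fin 2 → Bool) : Bool :=
  if a 0 = a 1 then a 0 else if S j (a 0) then a 0 else a 1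

/-- The set of literals of a family of binary operations. -/
def literals (f : Fin m → (Fin 2 → Bool) → Bool) : Literals m :=
  fun j b => f j ![b, !b] == b

/-- `y` lies between `z` and `z'` and agrees with `z` wherever the operation of `S` picks `z`. -/
def Literals.Admissible (S : Literals m) (z z' y : Evaluation m) : Prop :=
  ∀ k, (y k = z k ∨ y k = z' k) ∧ (z k ≠ z' k → S k (z k) = true → y k = z k)

/-- No admissible element of `X` has the value of `z'` on issue `l`, on which `z` and `z'`
differ. -/
def Literals.Forced (X : Set (Evaluation m)) (S : Literals m) (z z' : Evaluation m) (l : Fin m) :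
    Prop :=
  z l ≠ z' l ∧ ∀ y ∈ X, S.Admissible z z' y → y l ≠ z' l

/-- `S` contains every literal that it forces. -/
def Literals.Closed (X : Set (Evaluation m)) (S : Literals m) : Prop :=
  ∀ z ∈ X, ∀ z' ∈ X, ∀ l, S.Forced X z z' l → S l (z l) = true

/-- Induction on the Hamming distance. If the operation picks `z'` on some issue `q` where the two
differ, the literal there is not forced, so some admissible `y ∈ X` has `y q = z' q`. It is closer
to `z'`, and replacing `z` by `y` leaves the outcome unchanged. If there is no such `q`, the outcome
is `z`. -/
theorem Literals.Closed.op_mem {S : Literals m} (hS : S.Closed X) (d : ℕ) :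
    ∀ z ∈ X, ∀ z' ∈ X, (Finset.univ.filter fun k => z k ≠ z' k).card ≤ d →
      (fun j => S.op j ![z j, z' j]) ∈ X := by
  induction d with
  | zero =>
    intro z hz z' hz' h
    convert hz using 2 with j
    have : z j = z' j := by
      simp only [nonpos_iff_eq_zero, Finset.card_eq_zero, Finset.filter_eq_empty_iff] at h
      simpa using h (Finset.mem_univ j)
    simp [Literals.op, this]
  | succ d ih =>
    intro z hz z' hz' h
    by_cases hq : ∃ q, z q ≠ z' q ∧ S q (z q) = false
    · obtain ⟨q, hne, hq⟩ := hq
      have hnf : ¬ S.Forced X z z' q := fun hf => by simpa [hq] using hS z hz z' hz' q hf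
      simp only [Literals.Forced, not_and, not_forall, not_not] at hnf
      obtain ⟨y, hy, hadm, hyq⟩ := hnf hne
      have hlt : (Finset.univ.filter fun k => y k ≠ z' k).card ≤ d := by
        refine Nat.lt_succ_iff.1 (lt_of_lt_of_le (Finset.card_lt_card ?_) h)
        refine Finset.ssubset_iff_of_subset (fun k hk => ?_) |>.2
          ⟨q, by simpa using hne, by simpa using hyq⟩
        simp only [Finset.mem_filter, Finset.mem_univ, true_and] at hk ⊢
        rcases (hadm k).1 with h1 | h1
        · rwa [← h1]
        · exact absurd h1 hk
      convert ih y hy z' hz' hlt using 2 with j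
      obtain ⟨h1, h2⟩ := hadm j
      by_cases hj : z j = z' j
      · have : y j = z' j := by rcases h1 with h1 | h1 <;> simp [h1, hj]
        simp [Literals.op, hj, this]
      · by_cases hs : S j (z j) = true
        · rw [h2 hj hs]
        · rcases h1 with h1 | h1 <;> simp [Literals.op, h1, hj, hs]
    · push Not at hq
      convert hz using 2 with j
      by_cases hj : z j = z' j
      · simp [Literals.op, hj]
      · simp [Literals.op, hq j hj]

theorem Literals.Closed.isAggregator {S : Literals m} (hS : S.Closed X) :
    IsAggregator X S.op where
  conservative j a := by
    unfold Literals.op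
    split_ifs
    exacts [⟨0, rfl⟩, ⟨0, rfl⟩, ⟨1, rfl⟩]
  closed x hx := by
    convert hS.op_mem _ _ (hx 0) _ (hx 1) le_rfl using 2 with j
    simp [Literals.op, aggregate]

/-- The outcome of `f` on `z`, `z'` is itself an admissible element of `X`, so on a forced issue it
cannot take the value of `z'`. -/
theorem Literals.Forced.mem_of_subset {S : Literals m} {f : Fin m → (Fin 2 → Bool) → Bool}
    (hf : IsAggregator X f) (hS : ∀ j b, S j b = true → literals f j b = true)
    {z z' : Evaluation m} (hz : z ∈ X) (hz' : z' ∈ X) {l : Fin m} (h : S.Forced X z z' l) :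
    literals f l (z l) = true := by
  have hbool : ∀ j, z j ≠ z' j → z' j = !z j := fun j hj => by
    revert hj; cases z j <;> cases z' j <;> simp
  have hval : ∀ j, f j ![z j, z' j] = z j ∨ f j ![z j, z' j] = z' j := fun j => by
    obtain ⟨i, hi⟩ := hf.conservative j ![z j, z' j]
    rw [hi]
    fin_cases i <;> simp
  have hy : (fun j => f j ![z j, z' j]) ∈ X := by
    convert hf.closed ![z, z'] (fun i => by fin_cases i <;> assumption) using 2 with j
    congr 1
    funext i
    fin_cases i <;> rfl
  have := h.2 _ hy fun k => ⟨hval k, fun hk hs => by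
    simpa [literals, hbool k hk] using hS _ _ hs⟩
  simp only [literals, ← hbool l h.1, beq_iff_eq]
  exact (hval l).resolve_right this

theorem literals_op (S : Literals m) : literals S.op = S := by
  funext j b
  cases b <;> rcases h : S j _ <;> simp [literals, Literals.op, h]

theorem IsAggregator.eq_of_literals {f : Fin m → (Fin 2 → Bool) → Bool} (hf : IsAggregator X f)
    {j : Fin m} {d : Fin 2} (h : ∀ b, literals f j b = decide (d = 0)) (a : Fin 2 → Bool) :
    f j a = a d := by
  by_cases hab : a 0 = a 1
  · obtain ⟨i, hi⟩ := hf.conservative j a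
    rw [hi]
    fin_cases d <;> fin_cases i <;> simp [hab]
  · have ha : a = ![a 0, !a 0] := by
      funext i
      fin_cases i
      · rfl
      · revert hab
        simp only [Fin.mk_one, Matrix.cons_val_one]
        cases a 0 <;> cases a 1 <;> simp
    have := h (a 0)
    rw [literals, ← ha] at this
    obtain ⟨i, hi⟩ := hf.conservative j a
    revert this
    rw [hi]
    fin_cases d <;> fin_cases i <;> simp [hab, Ne.symm hab]

theorem IsAggregator.isDictatorialOn_iff_literals (hX : Nondegenerate X)
    {f : Fin m → (Fin 2 → Bool) → Bool} (hf : IsAggregator X f) :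
    IsDictatorialOn X f ↔ (∀ j b, literals f j b = true) ∨ (∀ j b, literals f j b = false) := by
  rw [hX.isDictatorialOn_iff]
  constructor
  · rintro ⟨d, hd⟩
    fin_cases d
    · exact Or.inl fun j b => by simp [literals, hd]
    · exact Or.inr fun j b => by simp [literals, hd]
  · rintro (h | h)
    · exact ⟨0, fun j => hf.eq_of_literals (d := 0) (by simpa using h j)⟩
    · exact ⟨1, fun j => hf.eq_of_literals (d := 1) (by simpa using h j)⟩

theorem literals_swap (f : Fin m → (Fin 2 → Bool) → Bool)
    (j : Fin m) (b : Bool) : literals (fun j a => f j (a ∘ ![1, 0])) j b = !literals f j (!b) := by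
  have e : (![b, !b] ∘ ![1, 0] : Fin 2 → Bool) = ![!b, b] := by
    funext i; fin_cases i <;> rfl
  simp only [literals, e, Bool.not_not]
  cases b <;> cases f j _ <;> rfl

/-- Up to exchanging the two individuals, the set of literals of a binary non-dictatorial
aggregator contains a literal of any given issue. -/
theorem admitsNonDictatorial_two_iff (hX : Nondegenerate X) (j₀ : Fin m) :
    AdmitsNonDictatorial X 2 ↔ ∃ f, IsAggregator X f ∧ (∃ b, literals f j₀ b = true) ∧
      ∃ j b, literals f j b = false := by
  constructor
  · rintro ⟨f, hf, hnd⟩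
    rw [hf.isDictatorialOn_iff_literals hX] at hnd
    push Not at hnd
    simp only [ne_eq, Bool.not_eq_true, Bool.not_eq_false] at hnd
    -- If `j₀` has no literal, exchanging the individuals gives it both, and a literal present
    -- elsewhere yields an absent one.
    by_cases h : ∃ b, literals f j₀ b = true
    · exact ⟨f, hf, h, hnd.1⟩
    · refine ⟨_, hf.minor ![1, 0], ?_, ?_⟩
      · push Not at h
        exact ⟨true, by simp [literals_swap, h]⟩
      · obtain ⟨j, b, hb⟩ := hnd.2
        exact ⟨j, !b, by simp [literals_swap, hb]⟩
  · rintro ⟨f, hf, ⟨b, hb⟩, j, b', hb'⟩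
    refine ⟨f, hf, ?_⟩
    rw [hf.isDictatorialOn_iff_literals hX]
    rintro (h | h)
    · simp [h] at hb'
    · simp [h] at hb

/-! ### Closing a set of literals -/

theorem le_foldl_of_inflationary {α β : Type*} [Preorder β] {f : β → α → β}
    (hf : ∀ s x, s ≤ f s x) (l : List α) (s : β) : s ≤ l.foldl f s := by
  induction l generalizing s with
  | nil => exact le_rfl
  | cons x l ih => exact (hf s x).trans (ih _)

/-- An increasing chain that ends where it began is constant. Hence a fixed point of
`Literals.round` is fixed by each single extension. -/
theorem eq_of_foldl_eq_self {α β : Type*} [PartialOrder β] {f : β → α → β}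
    (hf : ∀ s x, s ≤ f s x) {l : List α} {s : β} (h : l.foldl f s = s) : ∀ x ∈ l, f s x = s := by
  induction l with
  | nil => simp
  | cons y l ih =>
    have hy : f s y = s := le_antisymm ((le_foldl_of_inflationary hf l _).trans h.le) (hf s y)
    rw [List.foldl_cons, hy] at h
    simpa [hy] using ih h

theorem foldl_induction {α β : Type*} {P : β → Prop} {f : β → α → β} {l : List α}
    (hf : ∀ s, ∀ x ∈ l, P s → P (f s x)) {s : β} (hs : P s) : P (l.foldl f s) := by
  induction l generalizing s with
  | nil => exact hs
  | cons y l ih =>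
    exact ih (fun s x hx => hf s x (List.mem_cons_of_mem _ hx)) (hf s y List.mem_cons_self hs)

/-- If `F` still moves after `n` steps, it moved at every earlier step, since a fixed iterate stays
fixed; the rank would then exceed `n ≥ N`. -/
theorem iterate_fixed_of_rank {β : Type*} {F : β → β} (r : β → ℕ) {N : ℕ}
    (hr : ∀ s, F s ≠ s → r s < r (F s)) (hN : ∀ s, r s ≤ N) {n : ℕ} (hn : N ≤ n) (s : β) :
    F (F^[n] s) = F^[n] s := by
  by_contra h
  have key : ∀ k ≤ n + 1, k ≤ r (F^[k] s) := by
    intro k hk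
    induction k with
    | zero => exact Nat.zero_le _
    | succ k ih =>
      have hne : F (F^[k] s) ≠ F^[k] s := fun he => h <| by
        have : F^[n] s = F^[k] s := by
          obtain ⟨d, rfl⟩ := Nat.exists_eq_add_of_le' (Nat.le_of_succ_le_succ hk)
          rw [Function.iterate_add_apply, Function.iterate_fixed he]
        rw [this, he]
      rw [Function.iterate_succ_apply']
      exact (ih (by omega)).trans_lt (hr _ hne)
  have := key (n + 1) le_rfl
  have := hN (F^[n + 1] s)
  omega

open Classical in
/-- Add to `S` the literals that are forced by the pair `(z, z')`. -/
noncomputable def Literals.extend (X : Set (Evaluation m)) (z z' : Evaluation m) (S : Literals m) :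
    Literals m :=
  fun l b => S l b || decide (b = z l ∧ S.Forced X z z' l)

/-- Add to `S` the forced literals, for all pairs of elements of the list in turn. -/
noncomputable def Literals.round (rows : List (Evaluation m)) (S : Literals m) : Literals m :=
  rows.foldl (fun S z => rows.foldl (fun S z' => S.extend {x | x ∈ rows} z z') S) S

theorem Literals.le_iff {S T : Literals m} : S ≤ T ↔ ∀ j b, S j b = true → T j b = true :=
  Iff.rfl

theorem Literals.le_extend (z z' : Evaluation m) (S : Literals m) : S ≤ S.extend X z z' :=
  Literals.le_iff.2 fun j b h => by simp [Literals.extend, h]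

theorem Literals.le_round (rows : List (Evaluation m)) (S : Literals m) : S ≤ S.round rows :=
  le_foldl_of_inflationary (fun _ z => le_foldl_of_inflationary (fun S z' => S.le_extend z z') _ _)
    _ _

theorem Literals.closed_of_round_eq {rows : List (Evaluation m)} {S : Literals m}
    (h : S.round rows = S) : S.Closed {x | x ∈ rows} := by
  intro z hz z' hz' l hl
  have h1 := eq_of_foldl_eq_self
    (fun _ z => le_foldl_of_inflationary (fun S z' => S.le_extend z z') _ _) h z hz
  have h2 := eq_of_foldl_eq_self (fun S z' => S.le_extend z z') h1 z' hz'
  rw [← h2]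
  simp [Literals.extend, hl]

theorem Literals.round_le {rows : List (Evaluation m)} {f : Fin m → (Fin 2 → Bool) → Bool}
    (hf : IsAggregator {x | x ∈ rows} f) {S : Literals m} (hS : S ≤ literals f) :
    S.round rows ≤ literals f := by
  refine foldl_induction (P := (· ≤ literals f)) (fun S z hz hS => ?_) hS
  refine foldl_induction (P := (· ≤ literals f)) (fun S z' hz' hS => ?_) hS
  rw [Literals.le_iff] at hS ⊢
  intro l b hb
  simp only [Literals.extend, Bool.or_eq_true, decide_eq_true_eq] at hb
  rcases hb with hb | ⟨rfl, hb⟩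
  · exact hS l b hb
  · exact hb.mem_of_subset hf hS hz hz'

/-- The number of literals in a set. -/
def Literals.card (S : Literals m) : ℕ :=
  (Finset.univ.filter fun p : Fin m × Bool => S p.1 p.2 = true).card

theorem Literals.card_le (S : Literals m) : S.card ≤ 2 * m :=
  (Finset.card_le_univ _).trans (by simp [mul_comm])

theorem Literals.card_lt_card {S T : Literals m} (h : S ≤ T) (hne : T ≠ S) : S.card < T.card := by
  rw [Literals.le_iff] at h
  refine Finset.card_lt_card (Finset.ssubset_iff_subset_ne.2 ⟨fun p hp => ?_, fun he => hne ?_⟩)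
  · simp only [Finset.mem_filter, Finset.mem_univ, true_and] at hp ⊢
    exact h _ _ hp
  · funext j b
    have := Finset.ext_iff.1 he (j, b)
    simp only [Finset.mem_filter, Finset.mem_univ, true_and] at this
    exact (Bool.eq_iff_iff.2 this).symm

theorem Literals.round_iterate_closed (rows : List (Evaluation m)) (S : Literals m) {N : ℕ}
    (hN : 2 * m ≤ N) : ((Literals.round rows)^[N] S).Closed {x | x ∈ rows} :=
  closed_of_round_eq <| iterate_fixed_of_rank Literals.card
    (fun S => Literals.card_lt_card (S.le_round rows)) Literals.card_le hN S

/-- The set that consists of one literal of the first issue. -/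
def Literals.initial (m : ℕ) (u : Bool) : Literals m :=
  fun j b => decide (j.val = 0) && (b == u)

/-- The iterate is the literal set of an aggregator and lies below that of every aggregator with the
chosen literal. So if any of these misses a literal, the iterate does. -/
theorem admitsNonDictatorial_two_iff_round (hm : 1 ≤ m) {rows : List (Evaluation m)}
    (hX : Nondegenerate {x | x ∈ rows}) {N : ℕ} (hN : 2 * m ≤ N) :
    AdmitsNonDictatorial {x | x ∈ rows} 2 ↔
      ∃ u, ¬ ∀ j b, (Literals.round rows)^[N] (Literals.initial m u) j b = true := by
  rw [admitsNonDictatorial_two_iff hX ⟨0, hm⟩]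
  constructor
  · rintro ⟨f, hf, ⟨u, hu⟩, j, b, hjb⟩
    refine ⟨u, fun h => ?_⟩
    have h0 : Literals.initial m u ≤ literals f := Literals.le_iff.2 fun k c hk => by
      simp only [Literals.initial, Bool.and_eq_true, decide_eq_true_eq, beq_iff_eq] at hk
      rw [hk.2, ← hu]
      congr 1
      exact Fin.ext hk.1
    have hle : (Literals.round rows)^[N] (Literals.initial m u) ≤ literals f := by
      clear h hN
      induction N with
      | zero => exact h0
      | succ N ih =>
        rw [Function.iterate_succ_apply']
        exact Literals.round_le hf ih
    rw [Literals.le_iff] at hle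
    simpa [hjb] using hle j b (h j b)
  · rintro ⟨u, h⟩
    push Not at h
    obtain ⟨j, b, hjb⟩ := h
    refine ⟨_, (Literals.round_iterate_closed rows (Literals.initial m u) hN).isAggregator, ?_, ?_⟩
    · refine ⟨u, ?_⟩
      rw [literals_op]
      have hle : Literals.initial m u ≤ (Literals.round rows)^[N] (Literals.initial m u) :=
        Function.id_le_iterate_of_id_le (Literals.le_round rows) N _
      exact Literals.le_iff.1 hle _ _ (by simp [Literals.initial])
    · exact ⟨j, b, by rw [literals_op]; simpa using hjb⟩

end Aggregation

/-! ### A language of row programs and its compilation to stack machines -/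

namespace RowProgram

open Turing Turing.TM2 Turing.TM2.Stmt

/-- A row program acts on a state in `Q` and a row of cells in `C`, and reads a fixed list of rows
of bits through iterators in `ι`. -/
inductive Prog (ι Q C : Type) : Type
  /-- Update the state, then sweep over the cells, updating each cell and the state. -/
  | work (pre : Q → Q) (f : Q → C → C) (g : Q → C → Q) : Prog ι Q C
  /-- Run two programs in succession. -/
  | seq (p q : Prog ι Q C) : Prog ι Q C
  /-- For each row in turn, write it into the cells and run the program. -/
  | each (i : ι) (p : Prog ι Q C) : Prog ι Q C
  /-- Run the program as many times as the input has symbols. -/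
  | rounds (i : ι) (p : Prog ι Q C) : Prog ι Q C

/-- The stacks of the machine: input, output, the unread and the read part of each iterator, and
the cells to the left and to the right of the head. -/
inductive Stack (ι : Type) : Type
  | input | output | left | right
  | unread (i : ι)
  | read (i : ι)
  deriving DecidableEq, Fintype

/-- The labels of a sweep. -/
inductive WorkLabel : Type
  | start | forward | back
  deriving DecidableEq

instance : Fintype WorkLabel :=
  ⟨{.start, .forward, .back}, by rintro ⟨⟩ <;> simp⟩

/-- The labels of a loop over the rows. -/
inductive EachLabel : Type
  | rewind | top | row | back
  deriving DecidableEq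

instance : Fintype EachLabel :=
  ⟨{.rewind, .top, .row, .back}, by rintro ⟨⟩ <;> simp⟩

/-- The labels of a loop over the symbols. -/
inductive RoundsLabel : Type
  | rewind | top
  deriving DecidableEq

instance : Fintype RoundsLabel :=
  ⟨{.rewind, .top}, by rintro ⟨⟩ <;> simp⟩

variable {ι Q C Λ : Type}

/-- The alphabets of the stacks. -/
abbrev Alphabet (C : Type) : Stack ι → Type
  | .input => Option Bool
  | .output => Bool
  | .left => C
  | .right => C
  | .unread _ => Option Bool
  | .read _ => Option Bool

/-- The register of the machine: the state of the program and the symbols popped last. -/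
structure Register (Q C : Type) : Type where
  state : Q
  symbol : Option (Option Bool)
  cell : Option C
  deriving Fintype

/-- The register between two statements of a program. -/
abbrev Register.clear (r : Register Q C) : Register Q C := ⟨r.state, none, none⟩

/-- The contents of all stacks. -/
def tapes (inp : List (Option Bool)) (out : List Bool) (unread read : ι → List (Option Bool))
    (L R : List C) : ∀ k : Stack ι, List (Alphabet C k)
  | .input => inp
  | .output => out
  | .left => L
  | .right => R
  | .unread i => unread i
  | .read i => read i

/-! ### Stack operations in terms of `tapes` -/

section Tapes

variable [DecidableEq ι] {σ : Type} (inp : List (Option Bool)) (out : List Bool)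
  (U D : ι → List (Option Bool)) (L R : List C)

theorem update_tapes_input (x : List (Option Bool)) :
    Function.update (tapes inp out U D L R) .input x = tapes x out U D L R := by
  funext k; cases k <;> rfl

theorem update_tapes_output (x : List Bool) :
    Function.update (tapes inp out U D L R) .output x = tapes inp x U D L R := by
  funext k; cases k <;> rfl

theorem update_tapes_left (x : List C) :
    Function.update (tapes inp out U D L R) .left x = tapes inp out U D x R := by
  funext k; cases k <;> rfl

theorem update_tapes_right (x : List C) :
    Function.update (tapes inp out U D L R) .right x = tapes inp out U D L x := by
  funext k; cases k <;> rfl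

theorem update_tapes_unread (i : ι) (x : List (Option Bool)) :
    Function.update (tapes inp out U D L R) (.unread i) x =
      tapes inp out (Function.update U i x) D L R := by
  funext k
  cases k with
  | unread j =>
    by_cases h : j = i
    · subst h
      exact (Function.update_self ..).trans (Function.update_self j x U).symm
    · refine (Function.update_of_ne (fun he => h ?_) ..).trans (Function.update_of_ne h ..).symm
      injection he
  | _ => rfl

theorem update_tapes_read (i : ι) (x : List (Option Bool)) :
    Function.update (tapes inp out U D L R) (.read i) x =
      tapes inp out U (Function.update D i x) L R := by
  funext k
  cases k with
  | read j =>
    by_cases h : j = i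
    · subst h
      exact (Function.update_self ..).trans (Function.update_self j x D).symm
    · refine (Function.update_of_ne (fun he => h ?_) ..).trans (Function.update_of_ne h ..).symm
      injection he
  | _ => rfl

variable (v : σ) (q : Stmt (Alphabet (ι := ι) C) Λ σ)

@[simp] theorem stepAux_pop_input (f : σ → Option (Alphabet (ι := ι) C .input) → σ) :
    stepAux (pop .input f q) v (tapes inp out U D L R) =
      stepAux q (f v inp.head?) (tapes inp.tail out U D L R) :=
  congrArg (stepAux q _) (update_tapes_input ..)

@[simp] theorem stepAux_push_output (f : σ → Alphabet (ι := ι) C .output) :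
    stepAux (push .output f q) v (tapes inp out U D L R) =
      stepAux q v (tapes inp ((f v : Bool) :: out) U D L R) :=
  congrArg (stepAux q v) (update_tapes_output ..)

@[simp] theorem stepAux_push_left (f : σ → Alphabet (ι := ι) C .left) :
    stepAux (push .left f q) v (tapes inp out U D L R) =
      stepAux q v (tapes inp out U D ((f v : C) :: L) R) :=
  congrArg (stepAux q v) (update_tapes_left ..)

@[simp] theorem stepAux_pop_left (f : σ → Option (Alphabet (ι := ι) C .left) → σ) :
    stepAux (pop .left f q) v (tapes inp out U D L R) =
      stepAux q (f v L.head?) (tapes inp out U D L.tail R) :=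
  congrArg (stepAux q _) (update_tapes_left ..)

@[simp] theorem stepAux_push_right (f : σ → Alphabet (ι := ι) C .right) :
    stepAux (push .right f q) v (tapes inp out U D L R) =
      stepAux q v (tapes inp out U D L ((f v : C) :: R)) :=
  congrArg (stepAux q v) (update_tapes_right ..)

@[simp] theorem stepAux_pop_right (f : σ → Option (Alphabet (ι := ι) C .right) → σ) :
    stepAux (pop .right f q) v (tapes inp out U D L R) =
      stepAux q (f v R.head?) (tapes inp out U D L R.tail) :=
  congrArg (stepAux q _) (update_tapes_right ..)

@[simp] theorem stepAux_push_unread (i : ι) (f : σ → Alphabet (ι := ι) C (.unread i)) :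
    stepAux (push (.unread i) f q) v (tapes inp out U D L R) =
      stepAux q v (tapes inp out (Function.update U i ((f v : Option Bool) :: U i)) D L R) :=
  congrArg (stepAux q v) (update_tapes_unread ..)

@[simp] theorem stepAux_pop_unread (i : ι)
    (f : σ → Option (Alphabet (ι := ι) C (.unread i)) → σ) :
    stepAux (pop (.unread i) f q) v (tapes inp out U D L R) =
      stepAux q (f v (U i).head?) (tapes inp out (Function.update U i (U i).tail) D L R) :=
  congrArg (stepAux q _) (update_tapes_unread ..)

@[simp] theorem stepAux_peek_unread (i : ι)
    (f : σ → Option (Alphabet (ι := ι) C (.unread i)) → σ) :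
    stepAux (peek (.unread i) f q) v (tapes inp out U D L R) =
      stepAux q (f v (U i).head?) (tapes inp out U D L R) :=
  rfl

@[simp] theorem stepAux_push_read (i : ι) (f : σ → Alphabet (ι := ι) C (.read i)) :
    stepAux (push (.read i) f q) v (tapes inp out U D L R) =
      stepAux q v (tapes inp out U (Function.update D i ((f v : Option Bool) :: D i)) L R) :=
  congrArg (stepAux q v) (update_tapes_read ..)

@[simp] theorem stepAux_pop_read (i : ι) (f : σ → Option (Alphabet (ι := ι) C (.read i)) → σ) :
    stepAux (pop (.read i) f q) v (tapes inp out U D L R) =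
      stepAux q (f v (D i).head?) (tapes inp out U (Function.update D i (D i).tail) L R) :=
  congrArg (stepAux q _) (update_tapes_read ..)

end Tapes

namespace Prog

/-- The labels of the compiled program. -/
def Label : Prog ι Q C → Type
  | work _ _ _ => WorkLabel
  | seq p q => p.Label ⊕ q.Label
  | each _ p => EachLabel ⊕ p.Label
  | rounds _ p => RoundsLabel ⊕ p.Label

instance labelFintype : (p : Prog ι Q C) → Fintype p.Label
  | work _ _ _ => inferInstanceAs (Fintype WorkLabel)
  | seq p q => @instFintypeSum _ _ p.labelFintype q.labelFintype
  | each _ p => @instFintypeSum EachLabel _ _ p.labelFintype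
  | rounds _ p => @instFintypeSum RoundsLabel _ _ p.labelFintype

/-- The label at which the compiled program starts. -/
def entry : (p : Prog ι Q C) → p.Label
  | work _ _ _ => WorkLabel.start
  | seq p _ => Sum.inl p.entry
  | each _ _ => Sum.inl EachLabel.rewind
  | rounds _ _ => Sum.inl RoundsLabel.rewind

/-- The iterators that occur in a program. -/
def Uses (j : ι) : Prog ι Q C → Prop
  | work _ _ _ => False
  | seq p q => p.Uses j ∨ q.Uses j
  | each i p => j = i ∨ p.Uses j
  | rounds i p => j = i ∨ p.Uses j

/-- Nested loops use different iterators. -/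
def WellFormed : Prog ι Q C → Prop
  | work _ _ _ => True
  | seq p q => p.WellFormed ∧ q.WellFormed
  | each i p => ¬ p.Uses i ∧ p.WellFormed
  | rounds i p => ¬ p.Uses i ∧ p.WellFormed

end Prog

/-- A sweep over the cells. -/
def sweep (f : Q → C → C) (g : Q → C → Q) : Q → List C → Q × List C
  | q, [] => (q, [])
  | q, c :: W => ((sweep f g (g q c) W).1, f q c :: (sweep f g (g q c) W).2)

/-- The input word of a list of rows. -/
def word (rows : List (List Bool)) : List (Option Bool) :=
  rows.flatMap fun x => x.map some ++ [none]

/-- The effect of a program; `put i b c` is the cell `c` after writing `b` through iterator `i`. -/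
def Prog.den (put : ι → Bool → C → C) (rows : List (List Bool)) :
    Prog ι Q C → Q × List C → Q × List C
  | .work pre f g, s => sweep f g (pre s.1) s.2
  | .seq p q, s => q.den put rows (p.den put rows s)
  | .each i p, s => rows.foldl (fun s x => p.den put rows (s.1, List.zipWith (put i) x s.2)) s
  | .rounds _ p, s => (p.den put rows)^[(word rows).length] s

/-- A bound for the running time of a program, in the length of the input word. -/
noncomputable def Prog.time : Prog ι Q C → Polynomial ℕ
  -- One step to start, then a pass forward and a pass back, each with a last step that finds its
  -- stack empty.
  | .work _ _ _ => 2 * Polynomial.X + 3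
  | .seq p q => p.time + q.time
  -- `X + 2` pays for the rewinding and the final test. Each row costs a test, the writing of the
  -- row, the return of the head and the body.
  | .each _ p => Polynomial.X + 2 + Polynomial.X * (2 * Polynomial.X + 3 + p.time)
  | .rounds _ p => Polynomial.X + 2 + Polynomial.X * (1 + p.time)

variable [Inhabited C] (put : ι → Bool → C → C)

/-- Move the cells on the left to the right, then go to `next`. -/
def returnStmt (self next : Λ) : Stmt (Alphabet (ι := ι) C) Λ (Register Q C) :=
  pop .left (fun r c => { r with cell := c }) <|
  branch (fun r => r.cell.isSome)
    (push .right (fun r => (r.cell.getD default : C)) <| load Register.clear <| goto fun _ => self)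
    (goto fun _ => next)

/-- Move the symbols that iterator `i` has read back to its unread symbols, then go to `next`. -/
def rewindStmt (i : ι) (self next : Λ) : Stmt (Alphabet (ι := ι) C) Λ (Register Q C) :=
  pop (.read i) (fun r a => { r with symbol := a }) <|
  branch (fun r => r.symbol.isSome)
    (push (.unread i) (fun r => (r.symbol.getD none : Option Bool)) <| load Register.clear <|
      goto fun _ => self)
    (goto fun _ => next)

/-- The compiled program, with labels embedded in `Λ` by `e`; at its end it goes to `after`. -/
def Prog.code : (p : Prog ι Q C) → (p.Label → Λ) → Λ → p.Label →
    Stmt (Alphabet (ι := ι) C) Λ (Register Q C)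
  | .work pre _ _, e, _, WorkLabel.start =>
      load (fun r => { r with state := pre r.state }) <| goto fun _ => e WorkLabel.forward
  | .work _ f g, e, _, WorkLabel.forward =>
      pop .right (fun r c => { r with cell := c }) <|
      branch (fun r => r.cell.isSome)
        (push .left (fun r => (f r.state (r.cell.getD default) : C)) <|
          load (fun r => ⟨g r.state (r.cell.getD default), none, none⟩) <|
          goto fun _ => e WorkLabel.forward)
        (goto fun _ => e WorkLabel.back)
  | .work _ _ _, e, after, WorkLabel.back => returnStmt (e WorkLabel.back) after
  | .seq p q, e, _, .inl l => p.code (e ∘ Sum.inl) (e (.inr q.entry)) l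
  | .seq _ q, e, after, .inr l => q.code (e ∘ Sum.inr) after l
  | .each i _, e, _, .inl EachLabel.rewind =>
      rewindStmt i (e (.inl EachLabel.rewind)) (e (.inl EachLabel.top))
  | .each i _, e, after, .inl EachLabel.top =>
      peek (.unread i) (fun r a => { r with symbol := a }) <|
      branch (fun r => r.symbol.isSome)
        (load Register.clear <| goto fun _ => e (.inl EachLabel.row))
        (goto fun _ => after)
  | .each i _, e, _, .inl EachLabel.row =>
      pop (.unread i) (fun r a => { r with symbol := a }) <|
      push (.read i) (fun r => (r.symbol.getD none : Option Bool)) <|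
      branch (fun r => (r.symbol.getD none).isSome)
        (pop .right (fun r c => { r with cell := c }) <|
          push .left (fun r =>
            (put i ((r.symbol.getD none).getD false) (r.cell.getD default) : C)) <|
          load Register.clear <| goto fun _ => e (.inl EachLabel.row))
        (load Register.clear <| goto fun _ => e (.inl EachLabel.back))
  | .each _ p, e, _, .inl EachLabel.back =>
      returnStmt (e (.inl EachLabel.back)) (e (.inr p.entry))
  | .each _ p, e, _, .inr l => p.code (e ∘ Sum.inr) (e (.inl EachLabel.top)) l
  | .rounds i _, e, _, .inl RoundsLabel.rewind =>
      rewindStmt i (e (.inl RoundsLabel.rewind)) (e (.inl RoundsLabel.top))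
  | .rounds i p, e, after, .inl RoundsLabel.top =>
      pop (.unread i) (fun r a => { r with symbol := a }) <|
      branch (fun r => r.symbol.isSome)
        (push (.read i) (fun r => (r.symbol.getD none : Option Bool)) <| load Register.clear <|
          goto fun _ => e (.inr p.entry))
        (goto fun _ => after)
  | .rounds _ p, e, _, .inr l => p.code (e ∘ Sum.inr) (e (.inl RoundsLabel.top)) l

/-! ### Reachability within a number of steps -/

section Reachability

variable {K σ : Type} [DecidableEq K] {Γ : K → Type}

/-- The machine `M` gets from `c` to `c'` in at most `t` steps. -/
def ReachesIn (M : Λ → Stmt Γ Λ σ) (c c' : Cfg Γ Λ σ) (t : ℕ) : Prop :=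
  ∃ n ≤ t, (flip bind (step M))^[n] (some c) = some c'

variable {M : Λ → Stmt Γ Λ σ} {c c₁ c₂ : Cfg Γ Λ σ} {s t : ℕ}

theorem ReachesIn.trans (h₁ : ReachesIn M c c₁ s) (h₂ : ReachesIn M c₁ c₂ t) :
    ReachesIn M c c₂ (s + t) := by
  obtain ⟨a, ha, h₁⟩ := h₁
  obtain ⟨b, hb, h₂⟩ := h₂
  refine ⟨b + a, by omega, ?_⟩
  rw [Function.iterate_add_apply, h₁, h₂]

theorem ReachesIn.mono (h : ReachesIn M c c₁ s) (hst : s ≤ t) : ReachesIn M c c₁ t := by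
  obtain ⟨a, ha, h⟩ := h
  exact ⟨a, ha.trans hst, h⟩

theorem ReachesIn.single {l : Λ} {v : σ} {S : ∀ k, List (Γ k)} (h : stepAux (M l) v S = c) :
    ReachesIn M ⟨some l, v, S⟩ c 1 :=
  ⟨1, le_rfl, by simp [flip, step, h]⟩

theorem ReachesIn.head {l : Λ} {v : σ} {S : ∀ k, List (Γ k)} (h : stepAux (M l) v S = c)
    (h' : ReachesIn M c c₁ t) : ReachesIn M ⟨some l, v, S⟩ c₁ (t + 1) :=
  ((ReachesIn.single h).trans h').mono (by omega)

end Reachability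

end RowProgram

/-! ### Correctness and running time of compiled programs -/

namespace RowProgram

open Turing Turing.TM2 Turing.TM2.Stmt

variable {ι Q C Λ : Type}

theorem length_sweep (f : Q → C → C) (g : Q → C → Q) (q : Q) (W : List C) :
    (sweep f g q W).2.length = W.length := by
  induction W generalizing q with
  | nil => rfl
  | cons c W ih => simp [sweep, ih]

theorem length_den {rows : List (List Bool)} {m : ℕ} (hrows : ∀ x ∈ rows, x.length = m)
    (put : ι → Bool → C → C) (p : Prog ι Q C) (s : Q × List C) (hs : s.2.length = m) :
    (p.den put rows s).2.length = m := by
  induction p generalizing s with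
  | work pre f g => rw [Prog.den, length_sweep, hs]
  | seq p q hp hq => exact hq _ (hp s hs)
  | each i p hp =>
    refine Aggregation.foldl_induction (P := fun s : Q × List C => s.2.length = m)
      (fun s x hx hs => hp _ ?_) hs
    simp [hrows x hx, hs]
  | rounds i p hp =>
    rw [Prog.den]
    generalize (word rows).length = n
    induction n generalizing s with
    | zero => exact hs
    | succ n ih => exact ih _ (hp s hs)

@[simp] theorem word_cons (x : List Bool) (rows : List (List Bool)) :
    word (x :: rows) = x.map some ++ none :: word rows := by
  simp [word]

theorem length_le_length_word (rows : List (List Bool)) : rows.length ≤ (word rows).length := by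
  induction rows with
  | nil => simp
  | cons x rows ih => simp; omega

variable [DecidableEq ι]  {M : Λ → Stmt (Alphabet (ι := ι) C) Λ (Register Q C)}
  {inp : List (Option Bool)} {out : List Bool} {U D : ι → List (Option Bool)}

theorem rewindStmt_reaches {l next : Λ} {i : ι} (hM : M l = rewindStmt i l next) (q : Q)
    (L R : List C) (u d : List (Option Bool)) :
    ReachesIn M
      ⟨some l, ⟨q, none, none⟩,
        tapes inp out (Function.update U i u) (Function.update D i d) L R⟩
      ⟨some next, ⟨q, none, none⟩,
        tapes inp out (Function.update U i (d.reverse ++ u)) (Function.update D i []) L R⟩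
      (d.length + 1) := by
  induction d generalizing u with
  | nil => exact .single (by simp [-stepAux.eq_1, -stepAux.eq_2, -stepAux.eq_3, hM, rewindStmt])
  | cons a d ih =>
    refine .head (c := ⟨some l, ⟨q, none, none⟩,
      tapes inp out (Function.update U i (a :: u)) (Function.update D i d) L R⟩) ?_ ?_
    · simp [-stepAux.eq_1, -stepAux.eq_2, -stepAux.eq_3, hM, rewindStmt]
    · simpa using ih (a :: u)

variable [Inhabited C] {put : ι → Bool → C → C}

theorem returnStmt_reaches {l next : Λ} (hM : M l = returnStmt l next) (q : Q) (L R : List C) :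
    ReachesIn M ⟨some l, ⟨q, none, none⟩, tapes inp out U D L R⟩
      ⟨some next, ⟨q, none, none⟩, tapes inp out U D [] (L.reverse ++ R)⟩ (L.length + 1) := by
  induction L generalizing R with
  | nil => exact .single (by simp [-stepAux.eq_1, -stepAux.eq_2, -stepAux.eq_3, hM, returnStmt])
  | cons c L ih =>
    refine .head (c := ⟨some l, ⟨q, none, none⟩, tapes inp out U D L (c :: R)⟩) ?_ ?_
    · simp [-stepAux.eq_1, -stepAux.eq_2, -stepAux.eq_3, hM, returnStmt]
    · simpa using ih (c :: R)

theorem forward_reaches {pre : Q → Q} {f : Q → C → C} {g : Q → C → Q} {e : WorkLabel → Λ}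
    {after : Λ} (hM : M (e .forward) =
      Prog.code put (.work pre f g) e after WorkLabel.forward) (q : Q) (L R : List C) :
    ReachesIn M ⟨some (e .forward), ⟨q, none, none⟩, tapes inp out U D L R⟩
      ⟨some (e .back), ⟨(sweep f g q R).1, none, none⟩,
        tapes inp out U D ((sweep f g q R).2.reverse ++ L) []⟩ (R.length + 1) := by
  induction R generalizing q L with
  | nil =>
    exact .single (by simp [-stepAux.eq_1, -stepAux.eq_2, -stepAux.eq_3, hM, Prog.code, sweep])
  | cons c R ih =>
    refine .head (c := ⟨some (e .forward), ⟨g q c, none, none⟩,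
      tapes inp out U D (f q c :: L) R⟩) ?_ ?_
    · simp [-stepAux.eq_1, -stepAux.eq_2, -stepAux.eq_3, hM, Prog.code]
    · simpa [sweep] using ih (g q c) (f q c :: L)

theorem row_reaches {i : ι} {p : Prog ι Q C} {e : (Prog.each i p).Label → Λ} {after : Λ}
    (hM : M (e (.inl .row)) = Prog.code put (.each i p) e after (.inl .row)) (q : Q)
    (L R : List C) (x : List Bool) (hx : x.length = R.length) (u d : List (Option Bool)) :
    ReachesIn M
      ⟨some (e (.inl .row)), ⟨q, none, none⟩,
        tapes inp out (Function.update U i (x.map some ++ none :: u)) (Function.update D i d) L R⟩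
      ⟨some (e (.inl .back)), ⟨q, none, none⟩,
        tapes inp out (Function.update U i u)
          (Function.update D i (none :: (x.map some).reverse ++ d))
          ((List.zipWith (put i) x R).reverse ++ L) []⟩ (x.length + 1) := by
  induction x generalizing L R d with
  | nil =>
    obtain rfl := List.length_eq_zero_iff.1 hx.symm
    exact .single (by simp [-stepAux.eq_1, -stepAux.eq_2, -stepAux.eq_3, hM, Prog.code])
  | cons b x ih =>
    obtain _ | ⟨c, R⟩ := R
    · simp at hx
    refine .head (c := ⟨some (e (.inl .row)), ⟨q, none, none⟩,
      tapes inp out (Function.update U i (x.map some ++ none :: u))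
        (Function.update D i (some b :: d)) (put i b c :: L) R⟩) ?_ ?_
    · simp [-stepAux.eq_1, -stepAux.eq_2, -stepAux.eq_3, hM, Prog.code]
    · simpa using ih (put i b c :: L) R (by simpa using hx) (some b :: d)

/-- Between programs the head is at the left end and every iterator in use is exhausted, its read
part holding the reversed input. Each loop rewinds its iterator first and exhausts it again, so
loops can be nested and repeated. -/
theorem code_reaches {rows : List (List Bool)} {m : ℕ} (hrows : ∀ x ∈ rows, x.length = m)
    (hm : m ≤ (word rows).length) (p : Prog ι Q C) (hp : p.WellFormed) (e : p.Label → Λ) (after : Λ)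
    (hM : ∀ l, M (e l) = p.code put e after l)
    (hU : ∀ i, p.Uses i → U i = []) (hD : ∀ i, p.Uses i → D i = (word rows).reverse)
    (q : Q) (W : List C) (hW : W.length = m) :
    ReachesIn M ⟨some (e p.entry), ⟨q, none, none⟩, tapes inp out U D [] W⟩
      ⟨some after, ⟨(p.den put rows (q, W)).1, none, none⟩,
        tapes inp out U D [] (p.den put rows (q, W)).2⟩ (p.time.eval (word rows).length) := by
  induction p generalizing after U D q W with
  | work pre f g =>
    have hstart := hM WorkLabel.start
    simp only [Prog.code] at hstart
    have h1 : ReachesIn M ⟨some (e WorkLabel.start), ⟨q, none, none⟩, tapes inp out U D [] W⟩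
        ⟨some (e WorkLabel.forward), ⟨pre q, none, none⟩, tapes inp out U D [] W⟩ 1 :=
      .single (by simp [-stepAux.eq_1, -stepAux.eq_2, -stepAux.eq_3, hstart])
    have h2 := forward_reaches (inp := inp) (out := out) (U := U) (D := D) (hM .forward) (pre q)
      [] W
    have h3 := returnStmt_reaches (inp := inp) (out := out) (U := U) (D := D)
      (l := e WorkLabel.back) (hM .back) (sweep f g (pre q) W).1
      ((sweep f g (pre q) W).2.reverse ++ []) []
    have h := (h1.trans h2).trans h3
    simp only [List.append_nil, List.reverse_reverse, List.length_reverse, length_sweep] at h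
    refine h.mono ?_
    simp [Prog.time]
    omega
  | seq p₁ p₂ ih₁ ih₂ =>
    have h1 := ih₁ hp.1 (e ∘ Sum.inl) _ (fun l => hM (.inl l)) (fun i hi => hU i (.inl hi))
      (fun i hi => hD i (.inl hi)) q W hW
    have h2 := ih₂ hp.2 (e ∘ Sum.inr) after (fun l => hM (.inr l)) (fun i hi => hU i (.inr hi))
      (fun i hi => hD i (.inr hi)) (p₁.den put rows (q, W)).1
      (p₁.den put rows (q, W)).2 (length_den hrows put p₁ (q, W) hW)
    refine (h1.trans h2).mono ?_
    simp [Prog.time]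
  | each i p ih =>
    have htop := hM (.inl EachLabel.top)
    simp only [Prog.code] at htop
    have hUi : Function.update U i [] = U := by
      rw [← hU i (.inl rfl), Function.update_eq_self]
    have hDi : Function.update D i (word rows).reverse = D := by
      rw [← hD i (.inl rfl), Function.update_eq_self]
    have key : ∀ (todo : List (List Bool)) (d : List (Option Bool)) (q : Q) (W : List C),
        (∀ x ∈ todo, x.length = m) → W.length = m →
        ReachesIn M ⟨some (e (.inl EachLabel.top)), ⟨q, none, none⟩,
            tapes inp out (Function.update U i (word todo)) (Function.update D i d) [] W⟩
          ⟨some after, ⟨(todo.foldl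
              (fun s x => p.den put rows (s.1, List.zipWith (put i) x s.2)) (q, W)).1, none, none⟩,
            tapes inp out (Function.update U i [])
              (Function.update D i ((word todo).reverse ++ d)) []
              (todo.foldl (fun s x => p.den put rows (s.1, List.zipWith (put i) x s.2)) (q, W)).2⟩
          (todo.length * (2 * (word rows).length + 3 + p.time.eval (word rows).length) + 1) := by
      intro todo
      induction todo with
      | nil =>
        intro d q W _ _
        refine (ReachesIn.single ?_).mono (by omega)
        simp [-stepAux.eq_1, -stepAux.eq_2, -stepAux.eq_3, htop, word]
      | cons x todo iht =>
        intro d q W hx hW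
        have hxm := hx x List.mem_cons_self
        have h1 : ReachesIn M ⟨some (e (.inl EachLabel.top)), ⟨q, none, none⟩,
              tapes inp out (Function.update U i (word (x :: todo))) (Function.update D i d) [] W⟩
            ⟨some (e (.inl EachLabel.row)), ⟨q, none, none⟩,
              tapes inp out (Function.update U i (x.map some ++ none :: word todo))
                (Function.update D i d) [] W⟩ 1 :=
          .single (by cases x <;> simp [-stepAux.eq_1, -stepAux.eq_2, -stepAux.eq_3, htop])
        have h2 := row_reaches (inp := inp) (out := out) (U := U) (D := D) (hM (.inl .row)) q [] W x
          (hxm.trans hW.symm) (word todo) d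
        have h3 := returnStmt_reaches (inp := inp) (out := out)
          (U := Function.update U i (word todo))
          (D := Function.update D i (none :: (x.map some).reverse ++ d))
          (l := e (.inl EachLabel.back)) (hM (.inl .back)) q
          ((List.zipWith (put i) x W).reverse ++ []) []
        have hlen : (List.zipWith (put i) x W).length = m := by simp [hxm, hW]
        have h4 := ih hp.2 (e ∘ Sum.inr) (e (.inl .top)) (fun l => hM (.inr l))
          (U := Function.update U i (word todo))
          (D := Function.update D i (none :: (x.map some).reverse ++ d))
          -- The body does not use `i`, so the half-read iterator `i` does not affect the invariant
          -- that the body needs.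
          (fun j hj => by
            rw [Function.update_of_ne (by rintro rfl; exact hp.1 hj)]
            exact hU j (.inr hj))
          (fun j hj => by
            rw [Function.update_of_ne (by rintro rfl; exact hp.1 hj)]
            exact hD j (.inr hj))
          q (List.zipWith (put i) x W) hlen
        have h5 := iht (none :: (x.map some).reverse ++ d)
          (p.den put rows (q, List.zipWith (put i) x W)).1
          (p.den put rows (q, List.zipWith (put i) x W)).2
          (fun y hy => hx y (List.mem_cons_of_mem _ hy))
          (length_den hrows put p (q, _) hlen)
        simp only [List.append_nil, List.reverse_reverse, List.length_reverse, hlen] at h3 h2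
        have h := (((h1.trans h2).trans h3).trans h4).trans h5
        simp only [List.foldl_cons, word_cons, List.reverse_append, List.reverse_cons,
          List.append_assoc, List.cons_append, List.nil_append] at h ⊢
        refine h.mono ?_
        rw [hxm, List.length_cons, Nat.succ_mul todo.length]
        omega
    have h1 := rewindStmt_reaches (inp := inp) (out := out) (U := U) (D := D)
      (l := e (.inl EachLabel.rewind)) (i := i) (hM (.inl .rewind)) q [] W [] (word rows).reverse
    have h2 := key rows [] q W hrows hW
    simp only [List.reverse_reverse, List.append_nil, hUi, hDi] at h1 h2
    refine (h1.trans h2).mono ?_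
    have := Nat.mul_le_mul_right (2 * (word rows).length + 3 + p.time.eval (word rows).length)
      (length_le_length_word rows)
    simp only [Prog.time, Polynomial.eval_add, Polynomial.eval_mul, Polynomial.eval_X,
      Polynomial.eval_ofNat, List.length_reverse]
    omega
  | rounds i p ih =>
    have htop := hM (.inl RoundsLabel.top)
    simp only [Prog.code] at htop
    have hUi : Function.update U i [] = U := by
      rw [← hU i (.inl rfl), Function.update_eq_self]
    have hDi : Function.update D i (word rows).reverse = D := by
      rw [← hD i (.inl rfl), Function.update_eq_self]
    have key : ∀ (todo d : List (Option Bool)) (s : Q × List C), s.2.length = m →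
        ReachesIn M ⟨some (e (.inl RoundsLabel.top)), ⟨s.1, none, none⟩,
            tapes inp out (Function.update U i todo) (Function.update D i d) [] s.2⟩
          ⟨some after, ⟨((p.den put rows)^[todo.length] s).1, none, none⟩,
            tapes inp out (Function.update U i []) (Function.update D i (todo.reverse ++ d)) []
              ((p.den put rows)^[todo.length] s).2⟩
          (todo.length * (1 + p.time.eval (word rows).length) + 1) := by
      intro todo
      induction todo with
      | nil =>
        intro d s _
        refine (ReachesIn.single ?_).mono (by omega)
        simp [-stepAux.eq_1, -stepAux.eq_2, -stepAux.eq_3, htop]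
      | cons a todo iht =>
        intro d s hs
        have h1 : ReachesIn M ⟨some (e (.inl RoundsLabel.top)), ⟨s.1, none, none⟩,
              tapes inp out (Function.update U i (a :: todo)) (Function.update D i d) [] s.2⟩
            ⟨some (e (.inr p.entry)), ⟨s.1, none, none⟩,
              tapes inp out (Function.update U i todo) (Function.update D i (a :: d)) [] s.2⟩ 1 :=
          .single (by simp [-stepAux.eq_1, -stepAux.eq_2, -stepAux.eq_3, htop])
        have h2 := ih hp.2 (e ∘ Sum.inr) (e (.inl .top)) (fun l => hM (.inr l))
          (U := Function.update U i todo) (D := Function.update D i (a :: d))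
          (fun j hj => by
            rw [Function.update_of_ne (by rintro rfl; exact hp.1 hj)]
            exact hU j (.inr hj))
          (fun j hj => by
            rw [Function.update_of_ne (by rintro rfl; exact hp.1 hj)]
            exact hD j (.inr hj))
          s.1 s.2 hs
        have h3 := iht (a :: d) (p.den put rows s) (length_den hrows put p s hs)
        have h := (h1.trans h2).trans h3
        simp only [List.length_cons, Function.iterate_succ_apply, List.reverse_cons,
          List.append_assoc, List.cons_append, List.nil_append] at h ⊢
        refine h.mono ?_
        rw [Nat.succ_mul]
        omega
    have h1 := rewindStmt_reaches (inp := inp) (out := out) (U := U) (D := D)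
      (l := e (.inl RoundsLabel.rewind)) (i := i) (hM (.inl .rewind)) q [] W [] (word rows).reverse
    have h2 := key (word rows) [] (q, W) hW
    simp only [List.reverse_reverse, List.append_nil, hUi, hDi] at h1 h2
    refine (h1.trans h2).mono ?_
    simp only [Prog.time, Polynomial.eval_add, Polynomial.eval_mul, Polynomial.eval_X,
      Polynomial.eval_ofNat, Polynomial.eval_one, List.length_reverse]
    omega

end RowProgram

/-! ### The complete machine: loading the input, running the program, clearing the stacks -/

namespace RowProgram

open Turing Turing.TM2 Turing.TM2.Stmt

/-- The labels of the machine outside the compiled program: the copying of the first row and of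
the other rows of the input to the iterators, and the clearing of the stacks at the end. -/
inductive MainLabel : Type
  | copyFirst | copyRest | clear
  deriving DecidableEq

instance : Fintype MainLabel :=
  ⟨{.copyFirst, .copyRest, .clear}, by rintro ⟨⟩ <;> simp⟩

variable {Q C Λ : Type}

/-- Push the current symbol on the read part of all iterators. -/
def pushAll (s : Stmt (Alphabet (ι := Fin 4) C) Λ (Register Q C)) :
    Stmt (Alphabet (ι := Fin 4) C) Λ (Register Q C) :=
  push (.read 0) (fun r => (r.symbol.getD none : Option Bool)) <|
  push (.read 1) (fun r => (r.symbol.getD none : Option Bool)) <|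
  push (.read 2) (fun r => (r.symbol.getD none : Option Bool)) <|
  push (.read 3) (fun r => (r.symbol.getD none : Option Bool)) s

@[simp] theorem stepAux_pushAll (s : Stmt (Alphabet (ι := Fin 4) C) Λ (Register Q C))
    (v : Register Q C) (inp : List (Option Bool)) (out : List Bool)
    (U D : Fin 4 → List (Option Bool)) (L R : List C) :
    stepAux (pushAll s) v (tapes inp out U D L R) =
      stepAux s v (tapes inp out U (fun i => v.symbol.getD none :: D i) L R) := by
  simp only [pushAll, stepAux_push_read]
  congr 2
  funext i
  fin_cases i <;> simp

variable [Inhabited C]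

/-- The statements of the machine. -/
def mainCode (put : Fin 4 → Bool → C → C) (p : Prog (Fin 4) Q C) (q₀ : Q) (answer : Q → Bool) :
    MainLabel ⊕ p.Label → Stmt (Alphabet (ι := Fin 4) C) (MainLabel ⊕ p.Label) (Register Q C)
  | .inl .copyFirst =>
      pop .input (fun r a => { r with symbol := a }) <| pushAll <|
      branch (fun r => (r.symbol.getD none).isSome)
        (push .right (fun _ => (default : C)) <| load Register.clear <|
          goto fun _ => .inl .copyFirst)
        (load Register.clear <| goto fun _ => .inl .copyRest)
  | .inl .copyRest =>
      pop .input (fun r a => { r with symbol := a }) <|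
      branch (fun r => r.symbol.isSome)
        (pushAll <| load Register.clear <| goto fun _ => .inl .copyRest)
        (goto fun _ => .inr p.entry)
  | .inl .clear =>
      pop (.read 1) (fun r _ => r) <| pop (.read 2) (fun r _ => r) <|
      pop (.read 3) (fun r _ => r) <| pop .right (fun r _ => r) <|
      pop (.read 0) (fun r a => { r with symbol := a }) <|
      branch (fun r => r.symbol.isSome)
        (load Register.clear <| goto fun _ => .inl .clear)
        -- The configuration `haltList` carries the initial register.
        (push .output (fun r => (answer r.state : Bool)) <| load (fun _ => ⟨q₀, none, none⟩) halt)
  | .inr l => p.code put Sum.inr (.inl .clear) l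

variable {put : Fin 4 → Bool → C → C} {p : Prog (Fin 4) Q C} {q₀ : Q} {answer : Q → Bool}

/-- The first row also creates the cells, one per bit; this is how the machine learns the number of
issues. -/
theorem copyFirst_reaches (x : List Bool) (rest d : List (Option Bool)) (W : List C) :
    ReachesIn (mainCode put p q₀ answer)
      ⟨some (.inl .copyFirst), ⟨q₀, none, none⟩,
        tapes (x.map some ++ none :: rest) [] (fun _ => []) (fun _ => d) [] W⟩
      ⟨some (.inl .copyRest), ⟨q₀, none, none⟩,
        tapes rest [] (fun _ => []) (fun _ => none :: (x.map some).reverse ++ d) []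
          (List.replicate x.length default ++ W)⟩ (x.length + 1) := by
  induction x generalizing d W with
  | nil => exact .single (by simp [-stepAux.eq_1, -stepAux.eq_2, -stepAux.eq_3, mainCode])
  | cons b x ih =>
    refine .head (c := ⟨some (.inl .copyFirst), ⟨q₀, none, none⟩,
        tapes (x.map some ++ none :: rest) [] (fun _ => []) (fun _ => some b :: d) []
          (default :: W)⟩) (by simp [-stepAux.eq_1, -stepAux.eq_2, -stepAux.eq_3, mainCode]) ?_
    have := ih (some b :: d) (default :: W)
    simpa [List.replicate_succ', List.append_assoc] using this

theorem copyRest_reaches (w d : List (Option Bool)) (W : List C) :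
    ReachesIn (mainCode put p q₀ answer)
      ⟨some (.inl .copyRest), ⟨q₀, none, none⟩,
        tapes w [] (fun _ => []) (fun _ => d) [] W⟩
      ⟨some (.inr p.entry), ⟨q₀, none, none⟩,
        tapes [] [] (fun _ => []) (fun _ => w.reverse ++ d) [] W⟩ (w.length + 1) := by
  induction w generalizing d with
  | nil => exact .single (by simp [-stepAux.eq_1, -stepAux.eq_2, -stepAux.eq_3, mainCode])
  | cons a w ih =>
    refine .head (c := ⟨some (.inl .copyRest), ⟨q₀, none, none⟩,
        tapes w [] (fun _ => []) (fun _ => a :: d) [] W⟩)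
      (by simp [-stepAux.eq_1, -stepAux.eq_2, -stepAux.eq_3, mainCode]) ?_
    simpa using ih (a :: d)

/-- A halting machine must leave all stacks but the output empty. The four read parts have equal
length and there are no more cells than symbols, so one loop empties them all; popping an empty
stack is harmless. -/
theorem clear_reaches (q : Q) (d : List (Option Bool)) (W : List C) (hW : W.length ≤ d.length) :
    ReachesIn (mainCode put p q₀ answer)
      ⟨some (.inl .clear), ⟨q, none, none⟩, tapes [] [] (fun _ => []) (fun _ => d) [] W⟩
      ⟨none, ⟨q₀, none, none⟩, tapes [] [answer q] (fun _ => []) (fun _ => []) [] []⟩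
      (d.length + 1) := by
  have hupd : ∀ d d' : List (Option Bool), Function.update (Function.update (Function.update
      (Function.update (fun _ : Fin 4 => d) 1 d') 2 d') 3 d') 0 d' = fun _ => d' := by
    intro d d'
    funext i
    fin_cases i <;> rfl
  induction d generalizing W with
  | nil =>
    obtain rfl := List.length_eq_zero_iff.1 (Nat.le_zero.1 hW)
    exact .single (by simp [-stepAux.eq_1, -stepAux.eq_2, -stepAux.eq_3, mainCode])
  | cons a d ih =>
    refine .head (c := ⟨some (.inl .clear), ⟨q, none, none⟩,
      tapes [] [] (fun _ => []) (fun _ => d) [] W.tail⟩) ?_ (ih W.tail ?_)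
    · simp [-stepAux.eq_1, -stepAux.eq_2, -stepAux.eq_3, mainCode, hupd (a :: d) d]
    · simp only [List.length_tail, List.length_cons] at hW ⊢
      omega

variable [Fintype Q] [Fintype C]

/-- The stack machine of a row program. -/
def machine (put : Fin 4 → Bool → C → C) (p : Prog (Fin 4) Q C) (q₀ : Q) (answer : Q → Bool) :
    FinTM2 where
  K := Stack (Fin 4)
  k₀ := .input
  k₁ := .output
  Γ := Alphabet C
  Λ := MainLabel ⊕ p.Label
  main := .inl .copyFirst
  σ := Register Q C
  initialState := ⟨q₀, none, none⟩
  Γk₀Fin := inferInstanceAs (Fintype (Option Bool))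
  m := mainCode put p q₀ answer

theorem machine_outputs (hp : p.WellFormed) {rows : List (List Bool)} {m : ℕ}
    (hrows : ∀ x ∈ rows, x.length = m) (hne : rows ≠ []) :
    Nonempty (TM2OutputsInTime (machine put p q₀ answer) (word rows)
      (some [answer (p.den put rows (q₀, List.replicate m default)).1])
      ((2 * Polynomial.X + 3 + p.time).eval (word rows).length)) := by
  obtain ⟨x, rows', rfl⟩ := List.exists_cons_of_ne_nil hne
  have hx : x.length = m := hrows x List.mem_cons_self
  have hm : m ≤ (word (x :: rows')).length := by simp [hx]
  have h1 := copyFirst_reaches (put := put) (p := p) (q₀ := q₀) (answer := answer) x (word rows')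
    [] []
  have h2 := copyRest_reaches (put := put) (p := p) (q₀ := q₀) (answer := answer) (word rows')
    (none :: (x.map some).reverse ++ []) (List.replicate x.length default ++ [])
  have hD : (word rows').reverse ++ (none :: (x.map some).reverse ++ []) =
      (word (x :: rows')).reverse := by simp
  rw [hD] at h2
  simp only [List.append_nil, hx] at h1 h2
  have h3 := code_reaches (M := mainCode put p q₀ answer) (inp := []) (out := [])
    (U := fun _ => []) (D := fun _ => (word (x :: rows')).reverse) hrows hm p hp Sum.inr
    (.inl .clear) (fun _ => rfl) (fun _ _ => rfl) (fun _ _ => rfl) q₀ (List.replicate m default)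
    (by simp)
  have h4 := clear_reaches (put := put) (p := p) (q₀ := q₀) (answer := answer)
    (p.den put (x :: rows') (q₀, List.replicate m default)).1 (word (x :: rows')).reverse
    (p.den put (x :: rows') (q₀, List.replicate m default)).2
    (by rw [length_den hrows put p _ (by simp), List.length_reverse]; exact hm)
  obtain ⟨n, hn, h⟩ := ((h1.trans h2).trans h3).trans h4
  refine ⟨⟨⟨n, ?_⟩, hn.trans ?_⟩⟩
  · have hi : initList (machine put p q₀ answer) (word (x :: rows')) =
        ⟨some (.inl .copyFirst), ⟨q₀, none, none⟩,
          tapes (x.map some ++ none :: word rows') [] (fun _ => []) (fun _ => []) [] []⟩ := by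
      rw [← word_cons]
      unfold initList
      congr 1
      funext k
      cases k <;> rfl
    have ho : haltList (machine put p q₀ answer)
        [answer (p.den put (x :: rows') (q₀, List.replicate m default)).1] =
        ⟨none, ⟨q₀, none, none⟩, tapes []
          [answer (p.den put (x :: rows') (q₀, List.replicate m default)).1]
          (fun _ => []) (fun _ => []) [] []⟩ := by
      unfold haltList
      congr 1
      funext k
      cases k <;> rfl
    rw [hi, Option.map_some, ho]
    exact h
  · simp only [Polynomial.eval_add, Polynomial.eval_mul, Polynomial.eval_X, Polynomial.eval_ofNat,
      List.length_reverse]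
    have hl : (word (x :: rows')).length = m + (word rows').length + 1 := by simp [hx, add_assoc]
    omega

end RowProgram

/-! ### The decision procedure as a row program -/

namespace Aggregation

open RowProgram

/-- The flags of the decision procedure. -/
structure Flags : Type where
  ok : Bool
  found : Bool
  binary : Bool
  affine : Bool
  deriving Fintype

/-- The cell of an issue: the entries of the four current rows, the literals of the issue, and
whether an admissible row has been found. -/
structure Cell : Type where
  row : Fin 4 → Bool
  lit : Bool → Bool
  hit : Bool
  deriving Fintype, Inhabited

/-- Write an entry of the row with number `i`. -/
def Cell.put (i : Fin 4) (b : Bool) (c : Cell) : Cell :=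
  { c with row := Function.update c.row i b }

/-- A row program on cells. -/
abbrev Procedure : Type := Prog (Fin 4) Flags Cell

namespace Procedure

/-- Set the flags. -/
def assign (u : Flags → Flags) : Procedure := .work u (fun _ c => c) (fun q _ => q)

/-- Update all cells. -/
def update (f : Flags → Cell → Cell) : Procedure := .work id f (fun q _ => q)

/-- Let `ok` say whether all cells pass the test `t`. -/
def test (t : Cell → Bool) : Procedure :=
  .work (fun q => { q with ok := true }) (fun _ c => c) (fun q c => { q with ok := q.ok && t c })

/-- Start with one literal of the first issue. -/
def start (u : Bool) : Procedure :=
  -- During the sweep `ok` holds only at the first cell.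
  .work (fun q => { q with ok := true }) (fun q c => { c with lit := fun b => q.ok && (b == u) })
    (fun q _ => { q with ok := false })

/-- Mark the issues on which row `2`, if admissible, has the value of row `1`. -/
def markHits : Procedure :=
  .seq
    -- This is `Literals.Admissible` for the rows `0`, `1`, `2`.
    (test fun c => (c.row 2 == c.row 0 || c.row 2 == c.row 1) &&
      (c.row 0 == c.row 1 || !c.lit (c.row 0) || c.row 2 == c.row 0))
    (update fun q c => { c with hit := c.hit || (q.ok && (c.row 2 == c.row 1)) })

/-- Add the literals forced by the pair of the rows `0` and `1`. -/
def extend : Procedure :=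
  .seq (update fun _ c => { c with hit := false }) <|
  .seq (.each 2 markHits) <|
  update fun _ c =>
    { c with lit := fun b => c.lit b || ((b == c.row 0) && (c.row 0 != c.row 1) && !c.hit) }

/-- Close one literal of the first issue and record whether the result is not full. -/
def closure (u : Bool) : Procedure :=
  .seq (start u) <|
  -- The input has at least `2 * m` symbols, so this many rounds reach a closed set.
  .seq (.rounds 3 (.each 0 (.each 1 extend))) <|
  .seq (test fun c => c.lit true && c.lit false) <|
  assign fun q => { q with binary := q.binary || !q.ok }

/-- Record whether the sum of the rows `0`, `1`, `2` is in the list. -/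
def testSum : Procedure :=
  .seq (assign fun q => { q with found := false }) <|
  .seq (.each 3 (.seq (test fun c => c.row 3 == xor (xor (c.row 0) (c.row 1)) (c.row 2))
    (assign fun q => { q with found := q.found || q.ok }))) <|
  assign fun q => { q with affine := q.affine && q.found }

/-- The decision procedure. -/
def decision : Procedure :=
  .seq (closure true) <| .seq (closure false) <| .each 0 (.each 1 (.each 2 testSum))

theorem decision_wellFormed : decision.WellFormed := by
  simp [decision, closure, start, extend, markHits, testSum, assign, update, test,
    Prog.WellFormed, Prog.Uses]

end Procedure

/-! ### Effect of the procedures on the flags and cells -/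

theorem sweep_keep_state {Q C : Type} (f : Q → C → C) (q : Q) (W : List C) :
    sweep f (fun q _ => q) q W = (q, W.map (f q)) := by
  induction W with
  | nil => rfl
  | cons c W ih => simp [sweep, ih]

theorem sweep_test (t : Cell → Bool) (q : Flags) (W : List Cell) :
    sweep (fun _ c => c) (fun q c => { q with ok := q.ok && t c }) q W =
      ({ q with ok := q.ok && W.all t }, W) := by
  induction W generalizing q with
  | nil => simp [sweep]
  | cons c W ih => simp [sweep, ih, Bool.and_assoc]

variable {m : ℕ}

/-- The cells with given rows, literals and hits. -/
def cells (X : Fin 4 → Evaluation m) (S : Literals m) (h : Fin m → Bool) : List Cell :=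
  List.ofFn fun j => ⟨fun i => X i j, S j, h j⟩

theorem zipWith_put_cells (i : Fin 4) (x : Evaluation m) (X : Fin 4 → Evaluation m)
    (S : Literals m) (h : Fin m → Bool) :
    List.zipWith (Cell.put i) (List.ofFn x) (cells X S h) =
      cells (Function.update X i x) S h := by
  apply List.ext_getElem
  · simp [cells]
  · intro n h1 h2
    simp only [cells, Cell.put, List.getElem_zipWith, List.getElem_ofFn, Cell.mk.injEq, and_self,
      and_true]
    funext k
    by_cases hk : k = i
    · subst hk; simp
    · simp [Function.update_of_ne hk]

theorem map_cells (f : Cell → Cell) (X : Fin 4 → Evaluation m) (S : Literals m)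
    (h : Fin m → Bool) :
    (cells X S h).map f = List.ofFn fun j => f ⟨fun i => X i j, S j, h j⟩ := by
  simp [cells, List.map_ofFn, Function.comp_def]

theorem all_cells (t : Cell → Bool) (X : Fin 4 → Evaluation m) (S : Literals m)
    (h : Fin m → Bool) :
    (cells X S h).all t = true ↔ ∀ j, t ⟨fun i => X i j, S j, h j⟩ = true := by
  simp [cells, List.all_eq_true, List.mem_ofFn]

section Denotation

variable (rows : List (Evaluation m))

/-- The effect of a procedure on a list of evaluations. -/
abbrev effect (p : Procedure) : Flags × List Cell → Flags × List Cell :=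
  p.den Cell.put (rows.map List.ofFn)

theorem effect_seq (p p' : Procedure) (s : Flags × List Cell) :
    effect rows (.seq p p') s = effect rows p' (effect rows p s) := rfl

theorem effect_each (i : Fin 4) (p : Procedure) (s : Flags × List Cell) :
    effect rows (.each i p) s =
      rows.foldl
        (fun s x => effect rows p (s.1, List.zipWith (Cell.put i) (List.ofFn x) s.2)) s := by
  simp [effect, Prog.den, List.foldl_map]

theorem effect_assign (u : Flags → Flags) (q : Flags) (W : List Cell) :
    effect rows (Procedure.assign u) (q, W) = (u q, W) := by
  simp [effect, Procedure.assign, Prog.den, sweep_keep_state]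

theorem effect_update (f : Flags → Cell → Cell) (q : Flags) (W : List Cell) :
    effect rows (Procedure.update f) (q, W) = (q, W.map (f q)) := by
  simp [effect, Procedure.update, Prog.den, sweep_keep_state]

theorem effect_test (t : Cell → Bool) (q : Flags) (W : List Cell) :
    effect rows (Procedure.test t) (q, W) = ({ q with ok := W.all t }, W) := by
  simp [effect, Procedure.test, Prog.den, sweep_test]

variable (q : Flags) (X : Fin 4 → Evaluation m) (S : Literals m) (h : Fin m → Bool)

theorem effect_start (u : Bool) :
    ∃ ok, effect rows (Procedure.start u) (q, cells X S h) =
      ({ q with ok := ok }, cells X (Literals.initial m u) h) := by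
  cases m with
  | zero => exact ⟨true, by simp [effect, Procedure.start, Prog.den, cells, sweep]⟩
  | succ m =>
    have hrest : ∀ W : List Cell, sweep (fun q c => { c with lit := fun b => q.ok && (b == u) })
        (fun q _ => { q with ok := false }) { q with ok := false } W =
        ({ q with ok := false }, W.map fun c => { c with lit := fun _ => false }) := by
      intro W
      induction W with
      | nil => rfl
      | cons c W ih => simp [sweep, ih]
    refine ⟨false, ?_⟩
    simp only [effect, Procedure.start, Prog.den, cells, List.ofFn_succ, sweep, hrest]
    have h0 : Literals.initial (m + 1) u 0 = fun b => b == u := by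
      funext b; simp [Literals.initial]
    have hsucc : ∀ j : Fin m, Literals.initial (m + 1) u j.succ = fun _ => false := fun j => by
      funext b; simp [Literals.initial]
    simp [List.map_ofFn, Function.comp_def, h0, hsucc]

open Classical in
theorem effect_markHits : effect rows Procedure.markHits (q, cells X S h) =
    ({ q with ok := decide (S.Admissible (X 0) (X 1) (X 2)) },
      cells X S fun j => h j || (decide (S.Admissible (X 0) (X 1) (X 2)) && (X 2 j == X 1 j))) := by
  rw [Procedure.markHits, effect_seq, effect_test, effect_update, map_cells]
  have : (cells X S h).all (fun c => (c.row 2 == c.row 0 || c.row 2 == c.row 1) &&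
      (c.row 0 == c.row 1 || !c.lit (c.row 0) || c.row 2 == c.row 0)) =
      decide (S.Admissible (X 0) (X 1) (X 2)) := by
    rw [Bool.eq_iff_iff, all_cells, decide_eq_true_eq]
    refine forall_congr' fun j => ?_
    simp only [Bool.and_eq_true, Bool.or_eq_true, beq_iff_eq, Bool.not_eq_true']
    refine and_congr_right fun _ => ?_
    cases S j (X 0 j) <;> simp
    tauto
  rw [this]
  rfl

open Classical in
-- The existential quantifiers hide scratch data, here `ok` and the last row `2`, that is
-- overwritten before it is read again. The lemmas below follow the same pattern.
theorem effect_each_markHits (l : List (Evaluation m)) :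
    ∃ ok y, l.foldl (fun s x => effect rows Procedure.markHits
        (s.1, List.zipWith (Cell.put 2) (List.ofFn x) s.2)) (q, cells X S h) =
      ({ q with ok := ok }, cells (Function.update X 2 y) S fun j =>
        h j || l.any fun x => decide (S.Admissible (X 0) (X 1) x) && (x j == X 1 j)) := by
  induction l generalizing q X h with
  | nil => exact ⟨q.ok, X 2, by simp⟩
  | cons x l ih =>
    simp only [List.foldl_cons, zipWith_put_cells, effect_markHits]
    obtain ⟨ok, y, hy⟩ := ih { q with ok := decide (S.Admissible (X 0) (X 1) x) }
      (Function.update X 2 x)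
      (fun j => h j || (decide (S.Admissible (X 0) (X 1) x) && (x j == X 1 j)))
    refine ⟨ok, y, ?_⟩
    have h0 : Function.update X 2 x 0 = X 0 := rfl
    have h1 : Function.update X 2 x 1 = X 1 := rfl
    have h2 : Function.update X 2 x 2 = x := rfl
    simp only [h0, h1, h2, Function.update_idem] at hy ⊢
    rw [hy]
    simp [Bool.or_assoc]

open Classical in
theorem effect_extend : ∃ ok y h', effect rows Procedure.extend (q, cells X S h) =
    ({ q with ok := ok },
      cells (Function.update X 2 y) (S.extend {x | x ∈ rows} (X 0) (X 1)) h') := by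
  rw [Procedure.extend, effect_seq, effect_update, map_cells, effect_seq, effect_each]
  obtain ⟨ok, y, hy⟩ := effect_each_markHits rows q X S (fun _ => false) rows
  simp only [cells] at hy ⊢
  rw [hy, effect_update]
  refine ⟨ok, y, fun j => false || rows.any fun x =>
    decide (S.Admissible (X 0) (X 1) x) && (x j == X 1 j), Prod.ext rfl ?_⟩
  simp only [List.map_ofFn, Function.comp_def]
  congr 1
  funext j
  congr 1
  funext b
  have h0 : Function.update X 2 y 0 = X 0 := rfl
  have h1 : Function.update X 2 y 1 = X 1 := rfl
  rw [h0, h1, Bool.eq_iff_iff]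
  simp only [Literals.extend, Bool.or_eq_true, Bool.and_eq_true, beq_iff_eq,
    bne_iff_ne, decide_eq_true_eq, Bool.not_eq_true', Bool.false_or, List.any_eq_false]
  refine or_congr_right ?_
  rw [and_assoc, Literals.Forced]
  refine and_congr_right fun _ => and_congr_right fun _ => forall₂_congr fun x _ => ?_
  tauto

theorem effect_each_extend (l : List (Evaluation m)) :
    ∃ ok X' h', X' 0 = X 0 ∧ l.foldl (fun s x => effect rows Procedure.extend
        (s.1, List.zipWith (Cell.put 1) (List.ofFn x) s.2)) (q, cells X S h) =
      ({ q with ok := ok }, cells X'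
        (l.foldl (fun S z' => S.extend {x | x ∈ rows} (X 0) z') S) h') := by
  induction l generalizing q X S h with
  | nil => exact ⟨q.ok, X, h, rfl, rfl⟩
  | cons x l ih =>
    obtain ⟨ok, y, h', hx⟩ := effect_extend rows q (Function.update X 1 x) S h
    simp only [List.foldl_cons, zipWith_put_cells, hx]
    exact ih { q with ok := ok } (Function.update (Function.update X 1 x) 2 y) _ h'

theorem effect_round (l : List (Evaluation m)) :
    ∃ ok X' h', l.foldl (fun s x => effect rows (.each 1 Procedure.extend)
        (s.1, List.zipWith (Cell.put 0) (List.ofFn x) s.2)) (q, cells X S h) =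
      ({ q with ok := ok }, cells X' (l.foldl (fun S z =>
        rows.foldl (fun S z' => S.extend {x | x ∈ rows} z z') S) S) h') := by
  induction l generalizing q X S h with
  | nil => exact ⟨q.ok, X, h, rfl⟩
  | cons x l ih =>
    obtain ⟨ok, X', h', -, hx⟩ := effect_each_extend rows q (Function.update X 0 x) S h rows
    simp only [List.foldl_cons, zipWith_put_cells, effect_each] at hx ⊢
    rw [hx]
    simp only [effect_each] at ih
    exact ih { q with ok := ok } X' _ h'

theorem effect_rounds (n : ℕ) :
    ∃ ok X' h', (effect rows (.each 0 (.each 1 Procedure.extend)))^[n] (q, cells X S h) =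
      ({ q with ok := ok }, cells X' ((Literals.round rows)^[n] S) h') := by
  induction n generalizing q X S h with
  | zero => exact ⟨q.ok, X, h, rfl⟩
  | succ n ih =>
    obtain ⟨ok, X', h', hx⟩ := effect_round rows q X S h rows
    rw [Function.iterate_succ_apply, effect_each, hx, Function.iterate_succ_apply]
    exact ih { q with ok := ok } X' _ h'

open Classical in
theorem effect_closure (u : Bool) :
    ∃ (ok : Bool) (X' : Fin 4 → Evaluation m) (S' : Literals m) (h' : Fin m → Bool),
      effect rows (Procedure.closure u) (q, cells X S h) =
      ({ q with ok := ok, binary := q.binary || decide (¬ ∀ j b,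
        (Literals.round rows)^[(word (rows.map List.ofFn)).length] (Literals.initial m u) j b =
          true) }, cells X' S' h') := by
  obtain ⟨ok, hi⟩ := effect_start rows q X S h u
  obtain ⟨ok', X', h', hr⟩ := effect_rounds rows { q with ok := ok } X (Literals.initial m u) h
    (word (rows.map List.ofFn)).length
  rw [Procedure.closure, effect_seq, hi, effect_seq]
  have : effect rows (.rounds 3 (.each 0 (.each 1 Procedure.extend)))
    ({ q with ok := ok }, cells X (Literals.initial m u) h) = _ := hr
  rw [this, effect_seq, effect_test, effect_assign]
  set T := (Literals.round rows)^[(word (rows.map List.ofFn)).length] (Literals.initial m u)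
  have hall : (!(cells X' T h').all fun c => c.lit true && c.lit false) =
      decide (¬ ∀ j b, T j b = true) := by
    rw [Bool.eq_iff_iff, Bool.not_eq_true', ← Bool.not_eq_true, all_cells, decide_eq_true_eq]
    refine not_congr (forall_congr' fun j => ?_)
    simp [Bool.forall_bool, and_comm]
  refine ⟨(cells X' T h').all fun c => c.lit true && c.lit false, X', T, h', ?_⟩
  rw [← hall]

/-- The sum of three evaluations. -/
def rowSum (x y z : Evaluation m) : Evaluation m :=
  fun j => xor (xor (x j) (y j)) (z j)

open Classical in
theorem effect_testSum : ∃ ok found y, effect rows Procedure.testSum (q, cells X S h) =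
    ({ q with ok := ok, found := found,
              affine := q.affine && decide (rowSum (X 0) (X 1) (X 2) ∈ rows) },
      cells (Function.update X 3 y) S h) := by
  have key : ∀ (l : List (Evaluation m)) (q : Flags) (X : Fin 4 → Evaluation m), ∃ ok y,
      l.foldl (fun s x => effect rows
        (.seq (Procedure.test fun c => c.row 3 == xor (xor (c.row 0) (c.row 1)) (c.row 2))
          (Procedure.assign fun q => { q with found := q.found || q.ok }))
        (s.1, List.zipWith (Cell.put 3) (List.ofFn x) s.2)) (q, cells X S h) =
      ({ q with ok := ok, found := q.found || decide (rowSum (X 0) (X 1) (X 2) ∈ l) },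
        cells (Function.update X 3 y) S h) := by
    intro l
    induction l with
    | nil => exact fun q X => ⟨q.ok, X 3, by simp⟩
    | cons x l ih =>
      intro q X
      simp only [List.foldl_cons, zipWith_put_cells, effect_seq, effect_test, effect_assign] at ih ⊢
      have hall : (cells (Function.update X 3 x) S h).all
          (fun c => c.row 3 == xor (xor (c.row 0) (c.row 1)) (c.row 2)) =
          decide (rowSum (X 0) (X 1) (X 2) = x) := by
        rw [Bool.eq_iff_iff, all_cells, decide_eq_true_eq, funext_iff]
        refine forall_congr' fun j => ?_
        simp only [beq_iff_eq]
        exact eq_comm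
      rw [hall]
      obtain ⟨ok, y, hy⟩ := ih { q with
        ok := decide (rowSum (X 0) (X 1) (X 2) = x),
        found := q.found || decide (rowSum (X 0) (X 1) (X 2) = x) } (Function.update X 3 x)
      refine ⟨ok, y, hy.trans ?_⟩
      simp [Bool.or_assoc]
  rw [Procedure.testSum, effect_seq, effect_assign, effect_seq, effect_each]
  obtain ⟨ok, y, hy⟩ := key rows { q with found := false } X
  rw [hy, effect_assign]
  exact ⟨ok, decide (rowSum (X 0) (X 1) (X 2) ∈ rows), y, by simp⟩

open Classical in
theorem effect_each_testSum (l : List (Evaluation m)) :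
    ∃ ok found X', X' 0 = X 0 ∧ X' 1 = X 1 ∧ l.foldl (fun s x => effect rows Procedure.testSum
        (s.1, List.zipWith (Cell.put 2) (List.ofFn x) s.2)) (q, cells X S h) =
      ({ q with ok := ok, found := found,
                affine := q.affine && decide (∀ z ∈ l, rowSum (X 0) (X 1) z ∈ rows) },
        cells X' S h) := by
  induction l generalizing q X with
  | nil => exact ⟨q.ok, q.found, X, rfl, rfl, by simp⟩
  | cons x l ih =>
    obtain ⟨ok, found, y, hx⟩ := effect_testSum rows q (Function.update X 2 x) S h
    simp only [List.foldl_cons, zipWith_put_cells, hx]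
    obtain ⟨ok', found', X', h0, h1, hl⟩ := ih { q with
      ok := ok, found := found, affine := q.affine && decide (rowSum (X 0) (X 1) x ∈ rows) }
      (Function.update (Function.update X 2 x) 3 y)
    refine ⟨ok', found', X', h0, h1, hl.trans ?_⟩
    simp [Bool.and_assoc]

open Classical in
theorem effect_each_each_testSum (l : List (Evaluation m)) :
    ∃ ok found X', X' 0 = X 0 ∧ l.foldl (fun s x => effect rows (.each 2 Procedure.testSum)
        (s.1, List.zipWith (Cell.put 1) (List.ofFn x) s.2)) (q, cells X S h) =
      ({ q with ok := ok, found := found,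
                affine := q.affine && decide (∀ y ∈ l, ∀ z ∈ rows, rowSum (X 0) y z ∈ rows) },
        cells X' S h) := by
  induction l generalizing q X with
  | nil => exact ⟨q.ok, q.found, X, rfl, by simp⟩
  | cons x l ih =>
    obtain ⟨ok, found, Y, hY, -, hx⟩ := effect_each_testSum rows q (Function.update X 1 x) S h rows
    rw [← effect_each] at hx
    simp only [List.foldl_cons, zipWith_put_cells, hx]
    obtain ⟨ok', found', X', h0, hl⟩ := ih { q with
      ok := ok, found := found,
      affine := q.affine && decide (∀ z ∈ rows, rowSum (X 0) x z ∈ rows) } Y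
    -- Row `0` survives the inner loop, so the later passes form sums with the same first summand.
    replace hY : Y 0 = X 0 := hY
    refine ⟨ok', found', X', h0.trans hY, hl.trans ?_⟩
    simp [hY, Bool.and_assoc]

open Classical in
theorem effect_each_each_each_testSum (l : List (Evaluation m)) :
    ∃ ok found X', l.foldl (fun s x => effect rows (.each 1 (.each 2 Procedure.testSum))
        (s.1, List.zipWith (Cell.put 0) (List.ofFn x) s.2)) (q, cells X S h) =
      ({ q with ok := ok, found := found,
                affine := q.affine &&
                  decide (∀ x ∈ l, ∀ y ∈ rows, ∀ z ∈ rows, rowSum x y z ∈ rows) },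
        cells X' S h) := by
  induction l generalizing q X with
  | nil => exact ⟨q.ok, q.found, X, by simp⟩
  | cons x l ih =>
    obtain ⟨ok, found, Y, -, hx⟩ := effect_each_each_testSum rows q (Function.update X 0 x) S h rows
    rw [← effect_each] at hx
    simp only [List.foldl_cons, zipWith_put_cells, hx]
    obtain ⟨ok', found', X', hl⟩ := ih { q with
      ok := ok, found := found,
      affine := q.affine && decide (∀ y ∈ rows, ∀ z ∈ rows, rowSum x y z ∈ rows) } Y
    refine ⟨ok', found', X', hl.trans ?_⟩
    simp [Bool.and_assoc]

end Denotation

/-! ### Correctness and polynomial time of the decision procedure -/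

/-- The answer of the decision procedure. -/
def Flags.answer (q : Flags) : Bool := q.binary || q.affine

/-- The flags at the start. -/
def Flags.initial : Flags := ⟨false, false, false, true⟩

theorem answer_effect_decision (rows : List (Evaluation m)) :
    (effect rows Procedure.decision (Flags.initial, List.replicate m default)).1.answer = true ↔
      (∃ u, ¬ ∀ j b, (Literals.round rows)^[(word (rows.map List.ofFn)).length]
        (Literals.initial m u) j b = true) ∨ IsAffine {x | x ∈ rows} := by
  have hdef : List.replicate m (default : Cell) =
      cells (m := m) (fun _ _ => false) (fun _ _ => false) (fun _ => false) := by
    rw [cells, List.ofFn_const]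
    rfl
  rw [hdef, Procedure.decision, effect_seq, effect_seq]
  obtain ⟨ok₁, X₁, S₁, h₁, e₁⟩ := effect_closure rows Flags.initial (fun _ _ => false)
    (fun _ _ => false) (fun _ => false) true
  rw [e₁]
  obtain ⟨ok₂, X₂, S₂, h₂, e₂⟩ := effect_closure rows _ X₁ S₁ h₁ false
  rw [e₂, effect_each]
  obtain ⟨ok₃, found, X₃, e₃⟩ := effect_each_each_each_testSum rows _ X₂ S₂ h₂ rows
  rw [e₃]
  simp only [Flags.answer, Flags.initial, Bool.false_or, Bool.true_and, Bool.or_eq_true,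
    decide_eq_true_eq, Bool.exists_bool]
  exact or_congr or_comm Iff.rfl

theorem Instance.two_le_length (I : Instance) : 2 ≤ I.rows.length := by
  obtain ⟨x, hx, hxt⟩ := I.nondegenerate.exists_eq ⟨0, I.m_pos⟩ true
  obtain ⟨y, hy, hyf⟩ := I.nondegenerate.exists_eq ⟨0, I.m_pos⟩ false
  rw [Set.mem_ofPred_eq] at hx hy
  have hne : x ≠ y := by
    rintro rfl
    simp [hxt] at hyf
  match h : I.rows with
  | [] => simp [h] at hx
  | [a] =>
    simp only [h, List.mem_singleton] at hx hy
    exact absurd (hx.trans hy.symm) hne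
  | _ :: _ :: _ => simp

theorem Instance.encode_eq_word (I : Instance) : I.encode = word (I.rows.map List.ofFn) := by
  simp [Instance.encode, word, List.flatMap_map]

/-- Each row takes `m + 1` symbols and non-degeneracy gives at least two rows. This justifies
looping over the input symbols to close a set of literals. -/
theorem Instance.two_mul_le_length_word (I : Instance) :
    2 * I.m ≤ (word (I.rows.map List.ofFn)).length := by
  have : (word (I.rows.map List.ofFn)).length = I.rows.length * (I.m + 1) := by
    generalize I.rows = rows
    induction rows with
    | nil => simp [word]
    | cons x rows ih => simp [ih]; ring
  rw [this]
  exact Nat.mul_le_mul I.two_le_length (Nat.le_succ _)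

/-- The result of the decision procedure on an instance. -/
def Instance.decision (I : Instance) : Bool :=
  (effect I.rows Procedure.decision (Flags.initial, List.replicate I.m default)).1.answer

theorem Instance.decision_eq_true_iff (I : Instance) :
    I.decision = true ↔ AdmitsNonDictatorial I.X 2 ∨ IsAffine I.X := by
  rw [Instance.decision, answer_effect_decision, Instance.X,
    admitsNonDictatorial_two_iff_round I.m_pos I.nondegenerate I.two_mul_le_length_word]

theorem Instance.decision_outputs (I : Instance) :
    Nonempty (Turing.TM2OutputsInTime
      (machine Cell.put Procedure.decision Flags.initial Flags.answer) I.encode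
      (some (Computability.encodeBool I.decision))
      ((2 * Polynomial.X + 3 + Procedure.decision.time).eval I.encode.length)) := by
  rw [I.encode_eq_word]
  refine machine_outputs (m := I.m) Procedure.decision_wellFormed (fun x hx => ?_) ?_
  · obtain ⟨y, -, rfl⟩ := List.mem_map.1 hx
    simp
  · have := I.two_le_length
    intro h
    rw [List.map_eq_nil_iff] at h
    simp [h] at this

/-- The decision procedure runs in polynomial time on a stack machine. -/
noncomputable def decisionComputable :
    Turing.TM2ComputableInPolyTime Instance.encode Computability.encodeBool Instance.decision where
  tm := machine Cell.put Procedure.decision Flags.initial Flags.answer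
  inputAlphabet := Equiv.refl (Option Bool)
  outputAlphabet := Equiv.refl Bool
  time := 2 * Polynomial.X + 3 + Procedure.decision.time
  outputsFun I := by
    -- The alphabets are identified by identity equivalences, which leaves a `List.map id` around
    -- both words to be removed.
    have key : ∀ (l l' : List (Option Bool)) (o o' : List Bool) (t : ℕ), l = l' → o = o' →
        Turing.TM2OutputsInTime
          (machine Cell.put Procedure.decision Flags.initial Flags.answer) l' (some o') t →
        Turing.TM2OutputsInTime
          (machine Cell.put Procedure.decision Flags.initial Flags.answer) l (some o) t := by
      rintro _ _ _ _ _ rfl rfl h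
      exact h
    exact key _ _ _ _ _ (List.map_id I.encode) (List.map_id (Computability.encodeBool I.decision))
      I.decision_outputs.some

end Aggregation

theorem theorem2 :
    ∃ decide : Aggregation.Instance → Bool,
      Nonempty (Turing.TM2ComputableInPolyTime
        Aggregation.Instance.encode Computability.encodeBool decide) ∧
      ∀ I : Aggregation.Instance,
        (decide I = true ↔ Aggregation.IsPossibilityDomain I.X) ∧
        (decide I = true ↔
          (Aggregation.AdmitsNonDictatorial I.X 2 ∨ Aggregation.IsAffine I.X)) := by
  refine ⟨Aggregation.Instance.decision, ⟨Aggregation.decisionComputable⟩, fun I => ?_⟩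
  refine ⟨?_, I.decision_eq_true_iff⟩
  rw [I.decision_eq_true_iff]
  exact (Aggregation.isPossibilityDomain_iff I.m_pos I.nondegenerate).symm
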